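/- Consider the planar Stark problem $$\ddot x=-\frac{x}{r^3}+1,\qquad \ddot y=-\frac{y}{r^3},\qquad r=|q|=\sqrt{x^2+y^2},\quad q=(x,y),$$ with energy $H=\tfrac12|\dot q|^2-\tfrac1{|q|}-x$. Solutions are defined for all $t\in\mathbb R$; a solution that collides with the origin is continued by an elastic bounce (Levi-Civita regularization), i.e. if $q(t_0)=0$ then $q(t_0+s)=q(t_0-s)$ for all $s$. A brake orbit is a periodic solution whose velocity vanishes at some time (equilibria are included). Let $a\in(0,1]$ and, for $b\ge 0$, let $q$ be the solution with $q(0)=(a,0)$, $\dot q(0)=(0,b)$. Then $q$ is symmetric, $(x(-t),y(-t))=(x(t),-y(t))$, and: (i) $q$ is bounded if and only if $b\le\sqrt{\frac2a-2a}$. (ii) For $b=\sqrt{\frac2a-2a}$ the solution exists, is unique (denote it $q_a^*=(x_a^*,y_a^*)$), and is a brake orbit. Moreover: (iii) $|q_a^*|+x_a^*=2a$ at all times, and $H=-2a$. (iv) $\dot q_a^*(t)=0$ if and only if $|q_a^*(t)|=1$. (v) There is a sequence $(Q_n)$ of pairwise distinct solutions, none of them a time translate of $q_a^*$, each of which is asymptotic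 to $q_a^*$ both as $t\to+\infty$ and as $t\to-\infty$: there are $s_n^\pm\in\mathbb R$ such that $Q_n(t)-q_a^*(t+s_n^\pm)\to0$ and $\dot Q_n(t)-\dot q_a^*(t+s_n^\pm)\to0$ as $t\to\pm\infty$. If $a<1$, the $Q_n$ can be chosen free of collisions and such that no two of them agree up to a translation of time and a reflection in the $x$-axis. (vi) $q_a^*$ is bounded and never meets the negative $x$-axis $\{(x,0):x\le0\}$ (origin included), and, up to reflection in the $x$-axis, it is the only such solution with $q(0)=(a,0)$, whatever the initial velocity. -/

import Mathlib

open Filter Topology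
open scoped ComplexConjugate

/- The plane `ℝ²` is identified with `ℂ`: the position is `q = x + i y`, `‖q‖ = √(x² + y²)`,
and `conj` is the reflection in the `x`-axis. -/

/-- Right-hand side `(-x / r³ + 1, -y / r³)` of the planar Stark equation. -/
noncomputable def starkForce (q : ℂ) : ℂ := -q / (‖q‖ : ℂ) ^ 3 + 1

/-- The energy `H = |v|² / 2 - 1 / |q| - x` at position `q` and velocity `v`. -/
noncomputable def starkEnergy (q v : ℂ) : ℝ := ‖v‖ ^ 2 / 2 - 1 / ‖q‖ - q.re

/-- `q : ℝ → ℝ²` is a (complete) solution of the planar Stark problem, where collisions with the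
singularity at the origin, if there are any, are continued as elastic bounces.

In the Levi-Civita coordinates `z` with `q = z² / 2`, `dt = |z|² dτ`, the regularized equation is
invariant under `z ↦ -z`, so that a regularized motion with a collision `z (τ₀) = 0` satisfies
`z (τ₀ + σ) = - z (τ₀ - σ)`; that is, the orbit retraces its path after the collision. -/
structure IsStarkSolution (q : ℝ → ℂ) : Prop where
  /-- the motion is continuous, also at collisions -/
  continuous : Continuous q
  /-- away from collisions `q` is differentiable -/
  differentiableAt : ∀ t, q t ≠ 0 → DifferentiableAt ℝ q t
  /-- away from collisions Newton's equation `q'' = -q / |q|³ + (1, 0)` holds -/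
  newton : ∀ t, q t ≠ 0 → HasDerivAt (deriv q) (starkForce (q t)) t
  /-- collisions are isolated in time -/
  isolated : ∀ t₀, q t₀ = 0 → ∀ᶠ t in 𝓝[≠] t₀, q t ≠ 0
  /-- after a collision the motion retraces its path -/
  bounce : ∀ t₀, q t₀ = 0 → ∀ s, q (t₀ + s) = q (t₀ - s)

/-- `q` is the solution that starts at `(a, 0)` with velocity `(0, b)`. -/
def IsStarkSolutionFrom (a b : ℝ) (q : ℝ → ℂ) : Prop :=
  IsStarkSolution q ∧ q 0 = (a : ℂ) ∧ HasDerivAt q ((b : ℂ) * Complex.I) 0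

/-- A brake orbit: a periodic solution whose velocity vanishes at some time
(an equilibrium is a degenerate case). -/
def IsBrakeOrbit (q : ℝ → ℂ) : Prop :=
  IsStarkSolution q ∧ (∃ T : ℝ, 0 < T ∧ Function.Periodic q T) ∧ ∃ t, HasDerivAt q 0 t

/-- Along `l` (`atTop` or `atBot`) the motion `p` is asymptotic, in position and velocity,
to the motion `q` up to a shift of time. -/
def IsAsymptoticTo (p q : ℝ → ℂ) (l : Filter ℝ) : Prop :=
  ∃ s : ℝ, Tendsto (fun t => p t - q (t + s)) l (𝓝 0) ∧
    Tendsto (fun t => deriv p t - deriv q (t + s)) l (𝓝 0)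

/-- The motion never meets the negative `x`-axis `{(x, 0) : x ≤ 0}`; its end point, the origin, is
included, so that a collision counts as meeting it. -/
def AvoidsNegativeAxis (q : ℝ → ℂ) : Prop :=
  ∀ t, ¬ ((q t).im = 0 ∧ (q t).re ≤ 0)

/-! The Stark problem separates in parabolic coordinates. With `q = (u + i v)² / 2` and `dt = (u² +
v²) dτ`, one has `u² = ‖q‖ + x` and `v² = ‖q‖ - x`, and conservation of the energy `H` and of the
separation constant `E` gives `(du/dτ)² = u⁴ + 2 H u² + 2 E` and `(dv/dτ)² = -v⁴ + 2 H v² + 2 (2 -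
E)`. For `H < 0` the `u`-motion has unstable equilibria at `u² = -H`.

The start at `(a, 0)` with velocity `(0, b)` has `u² = 2 a` and `du/dτ = 0`, so everything depends
on the sign of `2 a + H`, which is the sign of `b² - (2 / a - 2 a)`. If it is positive, `u²` runs
off to infinity (`not_isBounded_of_escape`). If it is negative, `u²` stays trapped below `2 a`, and
the quartic term bounds `v`. If it is zero, `u` rests at the equilibrium: the orbit lies on the
parabola `‖q‖ + x = 2 a`, and `v` oscillates between its turning points (`exists_transverseMotion`),
which are the brake points.

For the uniqueness claim, a bounded solution avoiding the negative axis has `u > 0` for all time. It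
can never be beyond the equilibrium, so `u` is concave in `τ`; a positive concave function on the
line is constant (`parabolic_eq_neg_energy`).

The homoclinic solutions combine the same `v`-motion, with shifted phase, and the heteroclinic `u =
A tanh (A τ)` between `-A` and `A`, where `A² = 2 a` (`exists_homoclinic`). Replacing `u` by `-u`
reflects `q` in the `x`-axis, and the reflected parabolic orbit is its own shift by half a period,
so both ends approach the same orbit. The phase is visible in the point where `u = 0`, the only
meeting with the negative axis. `isStarkSolution_leviCivita` returns regularized motions to physical
time, and `IsStarkSolution.eq_of_eq` identifies solutions, also across collisions. -/

/-! ### Symmetries of the Stark problem -/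

lemma starkForce_conj (q : ℂ) : starkForce (conj q) = conj (starkForce q) := by
  simp [starkForce]

lemma deriv_comp_conj (q : ℝ → ℂ) (t : ℝ) :
    deriv (fun s => conj (q s)) t = conj (deriv q t) :=
  deriv.star

namespace IsStarkSolution

variable {q p : ℝ → ℂ}

lemma hasDerivAt (hq : IsStarkSolution q) {t : ℝ} (h : q t ≠ 0) :
    HasDerivAt q (deriv q t) t :=
  (hq.differentiableAt t h).hasDerivAt

lemma comp_add (hq : IsStarkSolution q) (s : ℝ) : IsStarkSolution fun t => q (t + s) where
  continuous := hq.continuous.comp (by fun_prop)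
  differentiableAt t h := by
    have := (hq.hasDerivAt h).comp_add_const t s
    exact this.differentiableAt
  newton t h := by
    have : deriv (fun t => q (t + s)) = fun t => deriv q (t + s) := by
      ext x; exact deriv_comp_add_const ..
    rw [this]
    exact (hq.newton _ h).comp_add_const t s
  isolated t₀ h := by
    have h1 := hq.isolated _ h
    have : Tendsto (fun t => t + s) (𝓝[≠] t₀) (𝓝[≠] (t₀ + s)) := by
      refine tendsto_nhdsWithin_iff.2 ⟨?_, ?_⟩
      · exact ((continuous_add_const s).tendsto t₀).mono_left nhdsWithin_le_nhds
      · filter_upwards [self_mem_nhdsWithin] with t ht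
        simpa using ht
    exact this.eventually h1
  bounce t₀ h r := by
    have := hq.bounce _ h r
    convert this using 2 <;> ring

lemma comp_neg (hq : IsStarkSolution q) : IsStarkSolution fun t => q (-t) where
  continuous := hq.continuous.comp (by fun_prop)
  differentiableAt t h := by
    have := (hq.differentiableAt _ h)
    exact this.comp t differentiable_neg.differentiableAt
  newton t h := by
    have : deriv (fun t => q (-t)) = fun t => -deriv q (-t) := by
      ext x; exact deriv_comp_neg ..
    rw [this]
    have := ((hq.newton _ h).scomp t (hasDerivAt_neg t)).neg
    rw [neg_one_smul, neg_neg] at this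
    exact this
  isolated t₀ h := by
    have h1 := hq.isolated _ h
    have : Tendsto (fun t => -t) (𝓝[≠] t₀) (𝓝[≠] (-t₀)) := by
      refine tendsto_nhdsWithin_iff.2 ⟨?_, ?_⟩
      · exact (continuous_neg.tendsto t₀).mono_left nhdsWithin_le_nhds
      · filter_upwards [self_mem_nhdsWithin] with t ht
        simpa using ht
    exact this.eventually h1
  bounce t₀ h r := by
    have := hq.bounce _ h (-r)
    convert this using 2 <;> ring

lemma comp_conj (hq : IsStarkSolution q) : IsStarkSolution fun t => conj (q t) where
  continuous := Complex.continuous_conj.comp hq.continuous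
  differentiableAt t h := by
    have h' : q t ≠ 0 := by simpa using h
    have := Complex.conjCLE.differentiableAt.comp t (hq.differentiableAt t h')
    exact this
  newton t h := by
    have h' : q t ≠ 0 := by simpa using h
    have : deriv (fun s => conj (q s)) = fun t => conj (deriv q t) :=
      funext (deriv_comp_conj q)
    rw [this, starkForce_conj]
    exact Complex.conjCLE.hasFDerivAt.comp_hasDerivAt t (hq.newton t h')
  isolated t₀ h := by
    have h' : q t₀ = 0 := by simpa using h
    filter_upwards [hq.isolated t₀ h'] with t ht
    simpa using ht
  bounce t₀ h r := by
    have h' : q t₀ = 0 := by simpa using h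
    simp only [hq.bounce t₀ h' r]

/-! ### Uniqueness -/

lemma contDiffAt_starkForce {z : ℂ} (hz : z ≠ 0) : ContDiffAt ℝ 1 starkForce z := by
  have h1 : ContDiffAt ℝ 1 (fun w : ℂ => ((‖w‖ : ℝ) : ℂ)) z :=
    Complex.ofRealCLM.contDiff.contDiffAt.comp z (contDiffAt_norm ℝ hz)
  have hn : ((‖z‖ : ℝ) : ℂ) ^ 3 ≠ 0 := by simpa using hz
  unfold starkForce
  simp only [div_eq_mul_inv]
  have h2 : ContDiffAt ℝ 1 (fun w : ℂ => -w) z := contDiffAt_id.neg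
  exact (h2.mul ((h1.pow 3).inv hn)).add contDiffAt_const

/-- Picard–Lindelöf for the first-order system in position and velocity, whose right-hand side is
`C¹` off the origin. -/
lemma eventually_eq_of_eq (hq : IsStarkSolution q) (hp : IsStarkSolution p) {t : ℝ}
    (h0 : q t = p t) (hne : q t ≠ 0) (hd : deriv q t = deriv p t) : q =ᶠ[𝓝 t] p := by
  have hc : ContDiffAt ℝ 1 (fun w : ℂ × ℂ => (w.2, starkForce w.1)) (q t, deriv q t) := by
    refine contDiffAt_snd.prodMk ?_
    exact ContDiffAt.comp (f := Prod.fst) (g := starkForce) (q t, deriv q t)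
      (contDiffAt_starkForce hne) contDiffAt_fst
  obtain ⟨K, s, hs, hK⟩ := hc.exists_lipschitzOnWith
  have key : ∀ f : ℝ → ℂ, IsStarkSolution f → f t ≠ 0 → (f t, deriv f t) = (q t, deriv q t) →
      ∀ᶠ τ in 𝓝 t, HasDerivAt (fun τ => (f τ, deriv f τ))
        ((fun w : ℂ × ℂ => (w.2, starkForce w.1)) (f τ, deriv f τ)) τ ∧
        (f τ, deriv f τ) ∈ s := by
    intro f hf hft he
    have e1 : ∀ᶠ τ in 𝓝 t, f τ ≠ 0 := hf.continuous.continuousAt.eventually_ne hft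
    have e2 : ∀ᶠ τ in 𝓝 t, (f τ, deriv f τ) ∈ s := by
      have : ContinuousAt (fun τ => (f τ, deriv f τ)) t :=
        hf.continuous.continuousAt.prodMk (hf.newton t hft).continuousAt
      exact this (show s ∈ 𝓝 (f t, deriv f t) by rw [he]; exact hs)
    filter_upwards [e1, e2] with τ h1 h2
    exact ⟨(hf.hasDerivAt h1).prodMk (hf.newton τ h1), h2⟩
  have := ODE_solution_unique_of_eventually (v := fun _ w => (w.2, starkForce w.1))
    (s := fun _ => s) (Eventually.of_forall fun _ => hK) (key q hq hne rfl)
    (key p hp (h0 ▸ hne) (by rw [h0, hd])) (by rw [h0, hd])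
  filter_upwards [this] with τ h
  exact (Prod.ext_iff.1 h).1

lemma eqOn_Ici_of_eq (hq : IsStarkSolution q) (hp : IsStarkSolution p)
    (h0 : q 0 = p 0) (hne : q 0 ≠ 0) (hd : deriv q 0 = deriv p 0) {t : ℝ} (ht : 0 ≤ t) :
    q t = p t := by
  have hcl : IsClosed {t | q t = p t} := isClosed_eq hq.continuous hp.continuous
  refine IsClosed.Icc_subset_of_forall_mem_nhdsGT_of_Icc_subset (a := 0) (b := t)
    (s := {t | q t = p t}) (hcl.inter isClosed_Icc) h0 ?_ ⟨ht, le_rfl⟩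
  intro T hT hsub
  have hTT : q T = p T := hsub ⟨hT.1, le_rfl⟩
  by_cases hz : q T = 0
  · have hT0 : 0 < T := lt_of_le_of_ne hT.1 (by rintro rfl; exact hne hz)
    -- At a collision the bounce rule replaces the differential equation: it copies the agreement on
    -- `(0, T)` to `(T, 2 T)`.
    have : Set.Ioo T (2 * T) ∈ 𝓝[>] T := Ioo_mem_nhdsGT (by linarith)
    filter_upwards [this] with s hs
    have h1 := hq.bounce T hz (s - T)
    have h2 := hp.bounce T (hTT ▸ hz) (s - T)
    have h3 : q (T - (s - T)) = p (T - (s - T)) :=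
      hsub ⟨by linarith [hs.2], by linarith [hs.1]⟩
    rw [← h1, ← h2] at h3
    simpa using h3
  · have hdT : deriv q T = deriv p T := by
      rcases hT.1.eq_or_lt with rfl | hT0
      · exact hd
      · have hu : UniqueDiffWithinAt ℝ (Set.Icc 0 T) T :=
          uniqueDiffOn_Icc hT0 T ⟨hT0.le, le_rfl⟩
        have e1 := (hq.hasDerivAt hz).hasDerivWithinAt (s := Set.Icc 0 T)
        have e2 := (hp.hasDerivAt (hTT ▸ hz)).hasDerivWithinAt (s := Set.Icc 0 T)
        have e3 := e2.congr (fun x hx => hsub hx) hTT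
        exact hu.eq_deriv _ e1 e3
    exact nhdsWithin_le_nhds (eventually_eq_of_eq hq hp hTT hz hdT)

/-- A solution is determined by its position and velocity off the singularity, also past
collisions. -/
lemma eq_of_eq (hq : IsStarkSolution q) (hp : IsStarkSolution p)
    (h0 : q 0 = p 0) (hne : q 0 ≠ 0) (hd : deriv q 0 = deriv p 0) : q = p := by
  funext t
  rcases le_total 0 t with ht | ht
  · exact eqOn_Ici_of_eq hq hp h0 hne hd ht
  · have := eqOn_Ici_of_eq hq.comp_neg hp.comp_neg (by simpa using h0) (by simpa using hne)
      (by simp [deriv_comp_neg, hd]) (neg_nonneg.2 ht)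
    simpa using this

end IsStarkSolution

namespace IsStarkSolutionFrom

variable {a b : ℝ} {q p : ℝ → ℂ}

lemma eq (ha : a ≠ 0) (hq : IsStarkSolutionFrom a b q) (hp : IsStarkSolutionFrom a b p) :
    q = p :=
  hq.1.eq_of_eq hp.1 (hq.2.1.trans hp.2.1.symm) (by rw [hq.2.1]; exact_mod_cast ha)
    (hq.2.2.deriv.trans hp.2.2.deriv.symm)

lemma comp_conj (hq : IsStarkSolutionFrom a b q) :
    IsStarkSolutionFrom a (-b) fun t => conj (q t) := by
  refine ⟨hq.1.comp_conj, by simp [hq.2.1], ?_⟩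
  have := Complex.conjCLE.hasFDerivAt.comp_hasDerivAt (0 : ℝ) hq.2.2
  have e : (Complex.conjCLE : ℂ →L[ℝ] ℂ) ((b : ℂ) * Complex.I) = ((-b : ℝ) : ℂ) * Complex.I := by
    simp
  rw [e] at this
  exact this

lemma comp_neg (hq : IsStarkSolutionFrom a b q) :
    IsStarkSolutionFrom a (-b) fun t => q (-t) := by
  refine ⟨hq.1.comp_neg, by simp [hq.2.1], ?_⟩
  have h : HasDerivAt q ((b : ℂ) * Complex.I) (-0) := by simpa using hq.2.2
  have := h.scomp (0 : ℝ) (hasDerivAt_neg 0)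
  rw [neg_one_smul, ← neg_mul, ← Complex.ofReal_neg] at this
  exact this

/-- Time reversal and reflection both change the initial data `(a, b)` into `(a, -b)`. -/
lemma neg_eq_conj (ha : a ≠ 0) (hq : IsStarkSolutionFrom a b q) (t : ℝ) :
    q (-t) = conj (q t) :=
  congrFun (eq ha hq.comp_neg hq.comp_conj) t

/-- A solution starting orthogonally to the axis and having a collision is periodic. -/
lemma isBounded_of_collision (ha : a ≠ 0) (hq : IsStarkSolutionFrom a b q) {t : ℝ}
    (ht : q t = 0) : Bornology.IsBounded (Set.range q) := by
  have ht0 : t ≠ 0 := by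
    rintro rfl
    rw [hq.2.1] at ht
    exact ha (by exact_mod_cast ht)
  -- Two reversals of time, about the collision and about `0`, compose to a translation; the second
  -- one costs a conjugation, so the period is `4 t`.
  have h1 : ∀ s, q (s + 2 * t) = conj (q s) := by
    intro s
    have := hq.1.bounce t ht (s + t)
    rw [show t - (s + t) = -s by ring, hq.neg_eq_conj ha] at this
    rw [← this]; congr 1; ring
  have h2 : Function.Periodic q (4 * t) := by
    intro s
    rw [show s + 4 * t = (s + 2 * t) + 2 * t by ring, h1, h1]; simp
  exact h2.isBounded_of_continuous (by simpa using ht0) hq.1.continuous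

end IsStarkSolutionFrom

/-! ### First integrals -/

/-- The derivative of the parabolic coordinate `‖q‖ + q.re` with respect to the regularized time,
`2 ‖q‖ d/dt`. -/
noncomputable def parabolicSpeed (q v : ℂ) : ℝ :=
  2 * ((q.re + ‖q‖) * v.re + q.im * v.im)

/-- The separation constant of the Stark problem, a component of a modified Runge-Lenz vector. -/
noncomputable def separationConst (q v : ℂ) : ℝ :=
  1 + q.re / ‖q‖ - (q.re * v.im - q.im * v.re) * v.im - q.im ^ 2 / 2

/-- Half the derivative of the cubic polynomial that bounds the parabolic coordinate. -/
noncomputable def parabolicForce (q v : ℂ) : ℝ :=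
  4 * separationConst q v + 8 * starkEnergy q v * (‖q‖ + q.re) + 6 * (‖q‖ + q.re) ^ 2

lemma sq_norm_eq (q : ℂ) : ‖q‖ ^ 2 = q.re ^ 2 + q.im ^ 2 := by
  rw [Complex.sq_norm, Complex.normSq_apply]; ring

lemma parabolicSpeed_sq {q : ℂ} (v : ℂ) (hq : q ≠ 0) :
    parabolicSpeed q v ^ 2 = 4 * (‖q‖ + q.re) *
      ((‖q‖ + q.re) ^ 2 + 2 * starkEnergy q v * (‖q‖ + q.re) + 2 * separationConst q v) := by
  have hr : ‖q‖ ≠ 0 := by simpa using hq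
  have h1 := sq_norm_eq q
  have h2 := sq_norm_eq v
  simp only [parabolicSpeed, starkEnergy, separationConst, h2]
  generalize ‖q‖ = r at *
  have hy : q.im ^ 2 = r ^ 2 - q.re ^ 2 := by linarith
  field_simp
  generalize q.re = x at *
  generalize q.im = y at *
  generalize v.re = X at *
  generalize v.im = Y at *
  grind

/-- The counterpart of `parabolicSpeed_sq` for the other parabolic coordinate. -/
lemma conjugate_parabolic_nonneg {q : ℂ} (v : ℂ) (hq : q ≠ 0) :
    0 ≤ (‖q‖ - q.re) *
      (-(‖q‖ - q.re) ^ 2 + 2 * starkEnergy q v * (‖q‖ - q.re) +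
        2 * (2 - separationConst q v)) := by
  have hr : ‖q‖ ≠ 0 := by simpa using hq
  have h1 := sq_norm_eq q
  have h2 := sq_norm_eq v
  -- The square on the right is that of `‖q‖ dη/dt` for `η = ‖q‖ - x`.
  have : (‖q‖ - q.re) *
      (-(‖q‖ - q.re) ^ 2 + 2 * starkEnergy q v * (‖q‖ - q.re) +
        2 * (2 - separationConst q v)) = ((q.re - ‖q‖) * v.re + q.im * v.im) ^ 2 := by
    simp only [starkEnergy, separationConst, h2]
    generalize ‖q‖ = r at *
    have hy : q.im ^ 2 = r ^ 2 - q.re ^ 2 := by linarith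
    field_simp
    generalize q.re = x at *
    generalize q.im = y at *
    generalize v.re = X at *
    generalize v.im = Y at *
    grind
  rw [this]
  positivity

namespace IsStarkSolution

variable {q : ℝ → ℂ} {t : ℝ}

lemma hasDerivAt_re (hq : IsStarkSolution q) (h : q t ≠ 0) :
    HasDerivAt (fun s => (q s).re) (deriv q t).re t :=
  Complex.reCLM.hasFDerivAt.comp_hasDerivAt t (hq.hasDerivAt h)

lemma hasDerivAt_im (hq : IsStarkSolution q) (h : q t ≠ 0) :
    HasDerivAt (fun s => (q s).im) (deriv q t).im t :=
  Complex.imCLM.hasFDerivAt.comp_hasDerivAt t (hq.hasDerivAt h)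

lemma starkForce_re (z : ℂ) : (starkForce z).re = -z.re / ‖z‖ ^ 3 + 1 := by
  have : (starkForce z) = ((1 / ‖z‖ ^ 3 : ℝ) : ℂ) * (-z) + 1 := by
    simp [starkForce]; ring
  rw [this]
  simp only [Complex.add_re, Complex.re_ofReal_mul, Complex.neg_re, Complex.one_re]; ring

lemma starkForce_im (z : ℂ) : (starkForce z).im = -z.im / ‖z‖ ^ 3 := by
  have : (starkForce z) = ((1 / ‖z‖ ^ 3 : ℝ) : ℂ) * (-z) + 1 := by
    simp [starkForce]; ring
  rw [this]
  simp only [Complex.add_im, Complex.im_ofReal_mul, Complex.neg_im, Complex.one_im]; ring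

lemma hasDerivAt_deriv_re (hq : IsStarkSolution q) (h : q t ≠ 0) :
    HasDerivAt (fun s => (deriv q s).re) (-(q t).re / ‖q t‖ ^ 3 + 1) t := by
  rw [← starkForce_re]
  exact Complex.reCLM.hasFDerivAt.comp_hasDerivAt t (hq.newton t h)

lemma hasDerivAt_deriv_im (hq : IsStarkSolution q) (h : q t ≠ 0) :
    HasDerivAt (fun s => (deriv q s).im) (-(q t).im / ‖q t‖ ^ 3) t := by
  rw [← starkForce_im]
  exact Complex.imCLM.hasFDerivAt.comp_hasDerivAt t (hq.newton t h)

lemma hasDerivAt_norm (hq : IsStarkSolution q) (h : q t ≠ 0) :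
    HasDerivAt (fun s => ‖q s‖)
      (((q t).re * (deriv q t).re + (q t).im * (deriv q t).im) / ‖q t‖) t := by
  have hr : ‖q t‖ ≠ 0 := by simpa using h
  have e : (fun s => ‖q s‖) = fun s => √((q s).re ^ 2 + (q s).im ^ 2) := by
    ext s; rw [← sq_norm_eq, Real.sqrt_sq (norm_nonneg _)]
  have h0 : (q t).re ^ 2 + (q t).im ^ 2 ≠ 0 := by rw [← sq_norm_eq]; positivity
  have := (((hq.hasDerivAt_re h).pow 2).add ((hq.hasDerivAt_im h).pow 2)).sqrt h0
  have e2 : √((q t).re ^ 2 + (q t).im ^ 2) = ‖q t‖ := (congrFun e t).symm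
  rw [e]
  refine this.congr_deriv ?_
  change _ / (2 * √((q t).re ^ 2 + (q t).im ^ 2)) = _
  rw [e2]
  field_simp
  norm_num
  ring

lemma hasDerivAt_parabolic (hq : IsStarkSolution q) (h : q t ≠ 0) :
    HasDerivAt (fun s => ‖q s‖ + (q s).re) (parabolicSpeed (q t) (deriv q t) / (2 * ‖q t‖)) t := by
  have hr : ‖q t‖ ≠ 0 := by simpa using h
  refine ((hq.hasDerivAt_norm h).add (hq.hasDerivAt_re h)).congr_deriv ?_
  simp only [parabolicSpeed]
  field_simp
  ring

lemma hasDerivAt_parabolicSpeed (hq : IsStarkSolution q) (h : q t ≠ 0) :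
    HasDerivAt (fun s => parabolicSpeed (q s) (deriv q s))
      (parabolicForce (q t) (deriv q t) / (2 * ‖q t‖)) t := by
  have hr : ‖q t‖ ≠ 0 := by simpa using h
  refine HasDerivAt.congr_deriv (((((hq.hasDerivAt_re h).add (hq.hasDerivAt_norm h)).mul
    (hq.hasDerivAt_deriv_re h)).add ((hq.hasDerivAt_im h).mul
    (hq.hasDerivAt_deriv_im h))).const_mul 2) ?_
  have h1 := sq_norm_eq (q t)
  have h2 := sq_norm_eq (deriv q t)
  simp only [parabolicForce, starkEnergy, separationConst, h2, Pi.add_apply]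
  generalize ‖q t‖ = r at *
  generalize (q t).re = x at *
  generalize (q t).im = y at *
  generalize (deriv q t).re = X at *
  generalize (deriv q t).im = Y at *
  have hy : y ^ 2 = r ^ 2 - x ^ 2 := by linarith
  field_simp
  grind

lemma hasDerivAt_energy (hq : IsStarkSolution q) (h : q t ≠ 0) :
    HasDerivAt (fun s => starkEnergy (q s) (deriv q s)) 0 t := by
  have hr : ‖q t‖ ≠ 0 := by simpa using h
  have e : (fun s => starkEnergy (q s) (deriv q s)) =
      fun s => ((deriv q s).re ^ 2 + (deriv q s).im ^ 2) / 2 - (‖q s‖)⁻¹ - (q s).re := by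
    ext s; simp only [starkEnergy, sq_norm_eq, one_div]
  rw [e]
  refine HasDerivAt.congr_deriv ((((((hq.hasDerivAt_deriv_re h).pow 2).add ((hq.hasDerivAt_deriv_im h).pow 2)).div_const
    2).sub ((hq.hasDerivAt_norm h).inv hr)).sub (hq.hasDerivAt_re h)) ?_
  field_simp
  ring

lemma hasDerivAt_separationConst (hq : IsStarkSolution q) (h : q t ≠ 0) :
    HasDerivAt (fun s => separationConst (q s) (deriv q s)) 0 t := by
  have hr : ‖q t‖ ≠ 0 := by simpa using h
  refine HasDerivAt.congr_deriv (((((hq.hasDerivAt_re h).div (hq.hasDerivAt_norm h) hr).const_add 1).sub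
    ((((hq.hasDerivAt_re h).mul (hq.hasDerivAt_deriv_im h)).sub
      ((hq.hasDerivAt_im h).mul (hq.hasDerivAt_deriv_re h))).mul (hq.hasDerivAt_deriv_im h))).sub
    (((hq.hasDerivAt_im h).pow 2).div_const 2)) ?_
  have h1 := sq_norm_eq (q t)
  simp only [Pi.sub_apply, Pi.mul_apply]
  generalize ‖q t‖ = r at *
  generalize (q t).re = x at *
  generalize (q t).im = y at *
  generalize (deriv q t).re = X at *
  generalize (deriv q t).im = Y at *
  have hy : y ^ 2 = r ^ 2 - x ^ 2 := by linarith
  field_simp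
  grind

end IsStarkSolution

/-! ### Escaping solutions -/

lemma mul_sub_le_sub_of_hasDerivAt {f f' : ℝ → ℝ} {a b c : ℝ} (hab : a ≤ b)
    (h : ∀ t ∈ Set.Icc a b, HasDerivAt f (f' t) t) (h0 : ∀ t ∈ Set.Icc a b, c ≤ f' t) :
    c * (b - a) ≤ f b - f a := by
  refine (convex_Icc a b).mul_sub_le_image_sub_of_le_deriv
    (fun t ht => (h t ht).continuousAt.continuousWithinAt)
    (fun t ht => (h t (interior_subset ht)).differentiableAt.differentiableWithinAt)
    (fun t ht => ?_) a ⟨le_rfl, hab⟩ b ⟨hab, le_rfl⟩ hab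
  rw [(h t (interior_subset ht)).deriv]
  exact h0 t (interior_subset ht)

lemma parabolic_nonneg (q : ℂ) : 0 ≤ ‖q‖ + q.re := by
  have := Complex.abs_re_le_norm q
  have := neg_abs_le q.re
  linarith

lemma parabolic_le (q : ℂ) : ‖q‖ + q.re ≤ 2 * ‖q‖ := by
  have := Complex.re_le_norm q
  linarith

lemma ne_zero_of_parabolic_pos {q : ℂ} (h : 0 < ‖q‖ + q.re) : q ≠ 0 := by
  rintro rfl
  simp at h

/-- With `ξ = ‖q‖ + x`, the force is `2 (ξ² + 2 H ξ + 2 E) + 4 ξ (ξ + H)`. The first bracket is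
nonnegative because `4 ξ` times it is a square. -/
lemma parabolicForce_pos {q v : ℂ} (hξ : 0 < ‖q‖ + q.re)
    (hH : 0 < ‖q‖ + q.re + starkEnergy q v) : 0 < parabolicForce q v := by
  have h1 := parabolicSpeed_sq v (ne_zero_of_parabolic_pos hξ)
  have h2 : 0 ≤ (‖q‖ + q.re) ^ 2 + 2 * starkEnergy q v * (‖q‖ + q.re) +
      2 * separationConst q v :=
    nonneg_of_mul_nonneg_right (h1 ▸ sq_nonneg _) (by positivity)
  have h3 := mul_pos hξ hH
  unfold parabolicForce
  nlinarith

namespace IsStarkSolution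

variable {q : ℝ → ℂ}

lemma eq_of_hasDerivAt_zero {f : ℝ → ℝ} {a b : ℝ} (hab : a ≤ b)
    (h : ∀ t ∈ Set.Icc a b, HasDerivAt f 0 t) : f b = f a := by
  have h1 := mul_sub_le_sub_of_hasDerivAt hab h (c := 0) (fun _ _ => le_rfl)
  have h2 := mul_sub_le_sub_of_hasDerivAt hab (fun t ht => (h t ht).neg) (c := 0)
    (fun _ _ => by simp)
  simp only [Pi.neg_apply] at h2
  linarith

lemma energy_eq (hq : IsStarkSolution q) {a b : ℝ} (hab : a ≤ b)
    (hne : ∀ t ∈ Set.Icc a b, q t ≠ 0) :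
    starkEnergy (q b) (deriv q b) = starkEnergy (q a) (deriv q a) :=
  eq_of_hasDerivAt_zero hab fun t ht => hq.hasDerivAt_energy (hne t ht)

lemma separationConst_eq (hq : IsStarkSolution q) {a b : ℝ} (hab : a ≤ b)
    (hne : ∀ t ∈ Set.Icc a b, q t ≠ 0) :
    separationConst (q b) (deriv q b) = separationConst (q a) (deriv q a) :=
  eq_of_hasDerivAt_zero hab fun t ht => hq.hasDerivAt_separationConst (hne t ht)

/-- As `H` and `E` are conserved, the force changes by `(ξ_T - ξ₀) (6 (ξ_T + ξ₀) + 8 H)`, and `ξ_T ≥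
ξ₀ > -H` makes the second factor positive. -/
lemma parabolicForce_le (hq : IsStarkSolution q) {T : ℝ} (hT : 0 ≤ T)
    (hne : ∀ t ∈ Set.Icc 0 T, q t ≠ 0)
    (hH : 0 < ‖q 0‖ + (q 0).re + starkEnergy (q 0) (deriv q 0))
    (hξ : ‖q 0‖ + (q 0).re ≤ ‖q T‖ + (q T).re) :
    parabolicForce (q 0) (deriv q 0) ≤ parabolicForce (q T) (deriv q T) := by
  unfold parabolicForce
  rw [hq.energy_eq hT hne, hq.separationConst_eq hT hne]
  have := parabolic_nonneg (q 0)
  nlinarith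

/-- A continuity induction: while `ξ ≥ ξ₀` the force stays positive, so the speed stays nonnegative
and `ξ` cannot fall below `ξ₀`. -/
lemma escape_segment (hq : IsStarkSolution q) (hξ : 0 < ‖q 0‖ + (q 0).re)
    (hW : 0 ≤ parabolicSpeed (q 0) (deriv q 0))
    (hH : 0 < ‖q 0‖ + (q 0).re + starkEnergy (q 0) (deriv q 0)) {T : ℝ} (hT : 0 ≤ T)
    (hne : ∀ t ∈ Set.Icc 0 T, q t ≠ 0) :
    ‖q 0‖ + (q 0).re ≤ ‖q T‖ + (q T).re ∧ 0 ≤ parabolicSpeed (q T) (deriv q T) := by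
  have hF := parabolicForce_pos hξ hH
  refine IsClosed.Icc_subset_of_forall_mem_nhdsWithin (a := 0) (b := T)
    (s := {t | ‖q 0‖ + (q 0).re ≤ ‖q t‖ + (q t).re ∧ 0 ≤ parabolicSpeed (q t) (deriv q t)})
    ?_ ⟨le_rfl, hW⟩ ?_ ⟨hT, le_rfl⟩
  · have c1 : ContinuousOn (fun t => ‖q t‖ + (q t).re) (Set.Icc 0 T) := fun t ht =>
      (hq.hasDerivAt_parabolic (hne t ht)).continuousAt.continuousWithinAt
    have c2 : ContinuousOn (fun t => parabolicSpeed (q t) (deriv q t)) (Set.Icc 0 T) := fun t ht =>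
      (hq.hasDerivAt_parabolicSpeed (hne t ht)).continuousAt.continuousWithinAt
    have := (c1.prodMk c2).preimage_isClosed_of_isClosed isClosed_Icc
      (t := Set.Ici (‖q 0‖ + (q 0).re) ×ˢ Set.Ici 0) (isClosed_Ici.prod isClosed_Ici)
    convert this using 1
    ext t
    simp [and_comm]
  · rintro x ⟨⟨hx1, hx2⟩, hx⟩
    have hx0 : q x ≠ 0 := hne x ⟨hx.1, hx.2.le⟩
    have e1 : ∀ᶠ t in 𝓝 x, q t ≠ 0 := hq.continuous.continuousAt.eventually_ne hx0
    have e2 : ∀ᶠ t in 𝓝 x, 0 < parabolicForce (q t) (deriv q t) := by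
      have c : ContinuousAt (fun t => parabolicForce (q t) (deriv q t)) x := by
        unfold parabolicForce
        have c1 := (hq.hasDerivAt_parabolic hx0).continuousAt
        have c2 := (hq.hasDerivAt_energy hx0).continuousAt
        have c3 := (hq.hasDerivAt_separationConst hx0).continuousAt
        exact ((c3.const_mul 4).add ((c2.const_mul 8).mul c1)).add ((c1.pow 2).const_mul 6)
      refine c.eventually_const_lt (hF.trans_le ?_)
      exact hq.parabolicForce_le hx.1 (fun t ht => hne t ⟨ht.1, ht.2.trans hx.2.le⟩) hH hx1
    obtain ⟨ε, hε, h⟩ := Metric.eventually_nhds_iff.1 (e1.and e2)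
    have hI : Set.Ioo x (x + ε) ∈ 𝓝[>] x := Ioo_mem_nhdsGT (by linarith)
    filter_upwards [hI] with y hy
    have hball : ∀ t ∈ Set.Icc x y, q t ≠ 0 ∧ 0 < parabolicForce (q t) (deriv q t) := by
      intro t ht
      refine h ?_
      rw [Real.dist_eq, abs_of_nonneg (by linarith [ht.1])]
      linarith [ht.2, hy.2]
    have hWt : ∀ t ∈ Set.Icc x y, 0 ≤ parabolicSpeed (q t) (deriv q t) := by
      intro t ht
      have := mul_sub_le_sub_of_hasDerivAt ht.1 (c := 0)
        (fun s hs => hq.hasDerivAt_parabolicSpeed (hball s ⟨hs.1, hs.2.trans ht.2⟩).1)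
        (fun s hs => by
          have := (hball s ⟨hs.1, hs.2.trans ht.2⟩).2
          positivity)
      linarith
    refine ⟨?_, hWt y ⟨hy.1.le, le_rfl⟩⟩
    have := mul_sub_le_sub_of_hasDerivAt hy.1.le (c := 0)
        (fun s hs => hq.hasDerivAt_parabolic (hball s hs).1)
        (fun s hs => by
          have := hWt s hs
          positivity)
    linarith

/-- Up to a first collision `ξ ≥ ξ₀ > 0`, whereas `ξ` is `0` at the origin. -/
lemma escape_ne_zero (hq : IsStarkSolution q) (hξ : 0 < ‖q 0‖ + (q 0).re)
    (hW : 0 ≤ parabolicSpeed (q 0) (deriv q 0))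
    (hH : 0 < ‖q 0‖ + (q 0).re + starkEnergy (q 0) (deriv q 0)) {t : ℝ} (ht : 0 ≤ t) :
    q t ≠ 0 := by
  intro h0
  set S := {s | 0 ≤ s ∧ q s = 0} with hS
  have hcl : IsClosed S :=
    isClosed_Ici.inter (isClosed_eq hq.continuous continuous_const)
  have hbd : BddBelow S := ⟨0, fun s hs => hs.1⟩
  obtain ⟨hT0, hT⟩ := hcl.csInf_mem ⟨t, ht, h0⟩ hbd
  set T := sInf S
  have hlt : ∀ s ∈ Set.Ico 0 T, ‖q 0‖ + (q 0).re ≤ ‖q s‖ + (q s).re := fun s hs =>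
    (hq.escape_segment hξ hW hH hs.1 fun r hr hr0 =>
      absurd (csInf_le hbd ⟨hr.1, hr0⟩) (not_le.2 (hr.2.trans_lt hs.2))).1
  have hTpos : 0 < T := by
    refine lt_of_le_of_ne hT0 fun h => ?_
    rw [← h] at hT
    exact ne_zero_of_parabolic_pos hξ hT
  have hclos : T ∈ closure (Set.Ico 0 T) := by
    rw [closure_Ico hTpos.ne]; exact ⟨hT0, le_rfl⟩
  have hc : Continuous fun s => ‖q s‖ + (q s).re :=
    hq.continuous.norm.add (Complex.continuous_re.comp hq.continuous)
  have := closure_minimal (t := {s | ‖q 0‖ + (q 0).re ≤ ‖q s‖ + (q s).re}) hlt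
    (isClosed_le continuous_const hc) hclos
  simp only [Set.mem_ofPred_eq, hT, norm_zero, Complex.zero_re] at this
  linarith

/-- Beyond the unstable equilibrium of the parabolic coordinate a solution that does not move
towards it escapes. -/
lemma not_isBounded_of_escape (hq : IsStarkSolution q) (hξ : 0 < ‖q 0‖ + (q 0).re)
    (hW : 0 ≤ parabolicSpeed (q 0) (deriv q 0))
    (hH : 0 < ‖q 0‖ + (q 0).re + starkEnergy (q 0) (deriv q 0)) :
    ¬ Bornology.IsBounded (Set.range q) := by
  intro hb
  obtain ⟨M, hM0, hM⟩ := hb.exists_pos_norm_le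
  replace hM : ∀ t, ‖q t‖ ≤ M := fun t => hM _ ⟨t, rfl⟩
  have hF := parabolicForce_pos hξ hH
  set κ := parabolicForce (q 0) (deriv q 0)
  have hne : ∀ t, 0 ≤ t → q t ≠ 0 := fun t ht => hq.escape_ne_zero hξ hW hH ht
  -- In a ball of radius `M` physical time is at most `2 M` times regularized time. So the speed
  -- grows at least linearly, and integrating once more makes `ξ` exceed `2 M`.
  have hW' : ∀ t, 0 ≤ t → κ / (2 * M) * t ≤ parabolicSpeed (q t) (deriv q t) := by
    intro t ht
    have := mul_sub_le_sub_of_hasDerivAt ht (c := κ / (2 * M))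
      (fun s hs => hq.hasDerivAt_parabolicSpeed (hne s hs.1)) (fun s hs => by
        have h1 := (hq.escape_segment hξ hW hH hs.1 fun r hr => hne r hr.1).1
        have h2 := hq.parabolicForce_le hs.1 (fun r hr => hne r hr.1) hH h1
        have h3 : 0 < ‖q s‖ := norm_pos_iff.2 (hne s hs.1)
        have h4 := hM s
        have h5 := hF.le.trans h2
        gcongr)
    linarith
  set δ := κ / (2 * M) with hδ
  have hδ0 : 0 < δ := by positivity
  have hξ' : ∀ t, 1 ≤ t → δ / (2 * M) * (t - 1) ≤ 2 * M := by
    intro t ht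
    have := mul_sub_le_sub_of_hasDerivAt ht (c := δ / (2 * M))
      (fun s hs => hq.hasDerivAt_parabolic (hne s (by linarith [hs.1]))) (fun s hs => by
        have h1 := hW' s (by linarith [hs.1])
        have h2 : δ ≤ parabolicSpeed (q s) (deriv q s) := by nlinarith [hs.1]
        have h3 : 0 < ‖q s‖ := norm_pos_iff.2 (hne s (by linarith [hs.1]))
        have h4 := hM s
        have h5 := hδ0.le.trans h2
        gcongr)
    have h5 := parabolic_le (q t)
    have h6 := parabolic_nonneg (q 1)
    linarith [hM t]
  have := hξ' (1 + (2 * M + 1) / (δ / (2 * M))) (by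
    have : 0 ≤ (2 * M + 1) / (δ / (2 * M)) := by positivity
    linarith)
  rw [add_sub_cancel_left, mul_div_cancel₀ _ (by positivity)] at this
  linarith

/-- A bounded solution that avoids the half line where the parabolic coordinate vanishes sits at
the unstable equilibrium of that coordinate. -/
lemma parabolic_eq_neg_energy (hq : IsStarkSolution q) (hξ : ∀ t, 0 < ‖q t‖ + (q t).re)
    (hb : Bornology.IsBounded (Set.range q)) (t : ℝ) :
    parabolicSpeed (q t) (deriv q t) = 0 ∧
      ‖q t‖ + (q t).re = -starkEnergy (q t) (deriv q t) := by
  have hne : ∀ t, q t ≠ 0 := fun t => ne_zero_of_parabolic_pos (hξ t)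
  have hr : ∀ t, 0 < ‖q t‖ := fun t => norm_pos_iff.2 (hne t)
  -- Beyond the equilibrium the solution would escape in the future or in the past, according to the
  -- sign of the speed.
  have hle : ∀ t, ‖q t‖ + (q t).re + starkEnergy (q t) (deriv q t) ≤ 0 := by
    intro t
    by_contra! hpos
    have hd : deriv (fun s => q (s + t)) 0 = deriv q t := by
      rw [deriv_comp_add_const, zero_add]
    rcases le_total 0 (parabolicSpeed (q t) (deriv q t)) with hW | hW
    · refine (hq.comp_add t).not_isBounded_of_escape (by simpa using hξ t) ?_ ?_ ?_
      · rw [hd]; simpa using hW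
      · rw [hd]; simpa using hpos
      · refine hb.subset ?_
        rintro _ ⟨s, rfl⟩
        exact ⟨_, rfl⟩
    · have hd' : deriv (fun s => q (-s + t)) 0 = -deriv q t := by
        have := deriv_comp_neg (fun s => q (s + t)) 0
        rw [this, neg_zero, hd]
      refine (hq.comp_add t).comp_neg.not_isBounded_of_escape (by simpa using hξ t) ?_ ?_ ?_
      · rw [hd']
        simp only [parabolicSpeed, neg_zero, zero_add, Complex.neg_re, Complex.neg_im] at hW ⊢
        linarith
      · rw [hd']
        simpa [starkEnergy] using hpos
      · refine hb.subset ?_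
        rintro _ ⟨s, rfl⟩
        exact ⟨_, rfl⟩
  obtain ⟨M, hM0, hM⟩ := hb.exists_pos_norm_le
  replace hM : ∀ t, ‖q t‖ ≤ M := fun t => hM _ ⟨t, rfl⟩
  set u : ℝ → ℝ := fun t => √(‖q t‖ + (q t).re) with hu
  -- `p = du/dτ`, and `dp/dτ = 2 u (ξ + H) ≤ 0`: this is the concavity of `u`.
  set p : ℝ → ℝ := fun t => parabolicSpeed (q t) (deriv q t) / (2 * u t) with hp
  have hu0 : ∀ t, 0 < u t := fun t => Real.sqrt_pos.2 (hξ t)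
  have husq : ∀ t, u t ^ 2 = ‖q t‖ + (q t).re := fun t => Real.sq_sqrt (hξ t).le
  have hu' : ∀ t, HasDerivAt u (p t / (2 * ‖q t‖)) t := by
    intro t
    refine ((hq.hasDerivAt_parabolic (hne t)).sqrt (hξ t).ne').congr_deriv ?_
    have h1 := (hr t).ne'
    have h2 := (hu0 t).ne'
    change _ / (2 * u t) = _
    simp only [hp]
    field_simp
  have hp' : ∀ t, HasDerivAt p
      (u t * (‖q t‖ + (q t).re + starkEnergy (q t) (deriv q t)) / ‖q t‖) t := by
    intro t
    have h1 := (hr t).ne'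
    have h2 := (hu0 t).ne'
    refine ((hq.hasDerivAt_parabolicSpeed (hne t)).div ((hu' t).const_mul 2)
      (by positivity)).congr_deriv ?_
    have h3 := parabolicSpeed_sq (deriv q t) (hne t)
    have h4 := husq t
    simp only [hp, parabolicForce]
    rw [← h4] at h3 ⊢
    generalize parabolicSpeed (q t) (deriv q t) = W at *
    generalize u t = u at *
    generalize starkEnergy (q t) (deriv q t) = H at *
    generalize separationConst (q t) (deriv q t) = E at *
    field_simp
    linear_combination (-1) * h3
  have hanti : ∀ s t, s ≤ t → p t ≤ p s := by
    intro s t hst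
    have := mul_sub_le_sub_of_hasDerivAt hst (fun r _ => (hp' r).neg) (c := 0) (fun r _ => by
      have h1 := hle r
      have h2 := hr r
      have h3 := hu0 r
      have h4 := div_nonpos_of_nonpos_of_nonneg
        (mul_nonpos_of_nonneg_of_nonpos h3.le h1) h2.le
      linarith)
    simp only [Pi.neg_apply] at this
    linarith
  -- A negative slope persists in the future and a positive one in the past; since `‖q‖ ≤ M`, either
  -- would drive `u` below zero.
  have hp0 : ∀ t, p t = 0 := by
    intro t
    rcases lt_trichotomy (p t) 0 with h | h | h
    · exfalso
      have key : ∀ s, t ≤ s → -p t / (2 * M) * (s - t) ≤ u t := by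
        intro s hs
        have := mul_sub_le_sub_of_hasDerivAt hs (fun r _ => (hu' r).neg) (c := -p t / (2 * M))
          (fun r hr' => by
            have h1 := hanti t r hr'.1
            have h2 := hr r
            have h3 := hM r
            have h4 : 0 ≤ -p r := by linarith
            have h5 : -p t / (2 * M) ≤ -p r / (2 * ‖q r‖) := by gcongr
            rwa [neg_div _ (p r)] at h5)
        simp only [Pi.neg_apply] at this
        linarith [hu0 s]
      have hc : 0 < -p t / (2 * M) := div_pos (by linarith) (by linarith)
      have hu1 := hu0 t
      have := key (t + (u t + 1) / (-p t / (2 * M))) (by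
        have : 0 ≤ (u t + 1) / (-p t / (2 * M)) := by positivity
        linarith)
      rw [add_sub_cancel_left, mul_div_cancel₀ _ hc.ne'] at this
      linarith
    · exact h
    · exfalso
      have key : ∀ s, s ≤ t → p t / (2 * M) * (t - s) ≤ u t := by
        intro s hs
        have := mul_sub_le_sub_of_hasDerivAt hs (fun r _ => hu' r) (c := p t / (2 * M))
          (fun r hr' => by
            have h1 := hanti r t hr'.2
            have h2 := hr r
            have h3 := hM r
            have h4 := h.le.trans h1
            gcongr)
        linarith [hu0 s]
      have hc : 0 < p t / (2 * M) := by positivity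
      have hu1 := hu0 t
      have := key (t - (u t + 1) / (p t / (2 * M))) (by
        have : 0 ≤ (u t + 1) / (p t / (2 * M)) := by positivity
        linarith)
      rw [sub_sub_cancel, mul_div_cancel₀ _ hc.ne'] at this
      linarith
  constructor
  · have h1 := hp0 t
    simp only [hp, div_eq_zero_iff] at h1
    rcases h1 with h1 | h1
    · exact h1
    · linarith [hu0 t]
  -- Since `p` vanishes identically, so does its derivative, which forces `ξ + H = 0`.
  · have hz : p = fun _ => 0 := funext hp0
    have h1 := hp' t
    rw [hz] at h1
    have h2 := h1.unique (hasDerivAt_const t 0)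
    rw [div_eq_zero_iff, mul_eq_zero] at h2
    rcases h2 with (h2 | h2) | h2
    · linarith [hu0 t]
    · linarith
    · linarith [hr t]

end IsStarkSolution

/-! ### Solutions starting orthogonally to the axis -/

namespace IsStarkSolutionFrom

variable {a b : ℝ} {q : ℝ → ℂ}

lemma not_isBounded (ha : 0 < a) (hq : IsStarkSolutionFrom a b q)
    (hb : 2 / a - 2 * a < b ^ 2) : ¬ Bornology.IsBounded (Set.range q) := by
  refine hq.1.not_isBounded_of_escape ?_ ?_ ?_
  all_goals simp only [hq.2.1, hq.2.2.deriv, parabolicSpeed, starkEnergy]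
  · simp; positivity
  · simp
  · simp [abs_of_pos ha]
    field_simp at hb ⊢
    nlinarith

/-- A collision makes the orbit periodic. Otherwise both integrals are conserved for all time, and
the squares of the two parabolic speeds confine `‖q‖ + x` and `‖q‖ - x` separately. -/
lemma isBounded (ha : 0 < a) (hq : IsStarkSolutionFrom a b q)
    (hb : b ^ 2 < 2 / a - 2 * a) : Bornology.IsBounded (Set.range q) := by
  by_cases hne : ∀ t, q t ≠ 0
  swap
  · push Not at hne
    obtain ⟨t, ht⟩ := hne
    exact hq.isBounded_of_collision ha.ne' ht
  have hH : ∀ t, starkEnergy (q t) (deriv q t) = b ^ 2 / 2 - 1 / a - a := by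
    have h0 : starkEnergy (q 0) (deriv q 0) = b ^ 2 / 2 - 1 / a - a := by
      simp [hq.2.1, hq.2.2.deriv, starkEnergy, abs_of_pos ha]
    intro t
    rcases le_total 0 t with ht | ht
    · rw [hq.1.energy_eq ht fun s _ => hne s, h0]
    · rw [← hq.1.energy_eq ht fun s _ => hne s, h0]
  have hE : ∀ t, separationConst (q t) (deriv q t) = 2 - a * b ^ 2 := by
    have h0 : separationConst (q 0) (deriv q 0) = 2 - a * b ^ 2 := by
      simp [hq.2.1, hq.2.2.deriv, separationConst, abs_of_pos ha, ha.ne']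
      ring
    intro t
    rcases le_total 0 t with ht | ht
    · rw [hq.1.separationConst_eq ht fun s _ => hne s, h0]
    · rw [← hq.1.separationConst_eq ht fun s _ => hne s, h0]
  have hcub : ∀ t, 0 ≤ (‖q t‖ + (q t).re) *
      ((‖q t‖ + (q t).re - 2 * a) * (‖q t‖ + (q t).re - (2 / a - b ^ 2))) := by
    intro t
    have h1 := parabolicSpeed_sq (deriv q t) (hne t)
    have h2 := sq_nonneg (parabolicSpeed (q t) (deriv q t))
    rw [h1, hH, hE] at h2
    have h3 : (‖q t‖ + (q t).re - 2 * a) * (‖q t‖ + (q t).re - (2 / a - b ^ 2)) =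
        (‖q t‖ + (q t).re) ^ 2 + 2 * (b ^ 2 / 2 - 1 / a - a) * (‖q t‖ + (q t).re) +
        2 * (2 - a * b ^ 2) := by
      field_simp
      ring
    rw [h3]
    nlinarith
  have hc : Continuous fun s => ‖q s‖ + (q s).re :=
    hq.1.continuous.norm.add (Complex.continuous_re.comp hq.1.continuous)
  have hle : ∀ t, ‖q t‖ + (q t).re ≤ 2 * a := by
    intro t
    by_contra! hlt
    -- The cubic is negative strictly between its roots `2 a` and `2 / a - b²`. A motion leaving `2
    -- a` upwards would take the value `(2 a + m) / 2` in this gap.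
    set m := min (‖q t‖ + (q t).re) (2 / a - b ^ 2) with hm
    have hm1 : 2 * a < m := lt_min hlt (by linarith)
    have hm2 := min_le_left (‖q t‖ + (q t).re) (2 / a - b ^ 2)
    have hm3 := min_le_right (‖q t‖ + (q t).re) (2 / a - b ^ 2)
    rw [← hm] at hm2 hm3
    have h0 : ‖q 0‖ + (q 0).re = 2 * a := by
      rw [hq.2.1]; simp [abs_of_pos ha]; ring
    obtain ⟨s, hs⟩ := mem_range_of_exists_le_of_exists_ge (c := (2 * a + m) / 2) hc
      ⟨0, by rw [h0]; linarith⟩ ⟨t, by linarith⟩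
    have h1 := hcub s
    simp only at hs
    rw [hs] at h1
    have : ((2 * a + m) / 2) * (((2 * a + m) / 2 - 2 * a) *
        ((2 * a + m) / 2 - (2 / a - b ^ 2))) < 0 :=
      mul_neg_of_pos_of_neg (by linarith) (mul_neg_of_pos_of_neg (by linarith) (by linarith))
    linarith
  -- Here `2 - E = a b²` and `H < 0`, so `η² ≤ 2 a b²` when `η > 0`; the summand `1` avoids a square
  -- root.
  have hconj : ∀ t, ‖q t‖ - (q t).re ≤ 2 * a * b ^ 2 + 1 := by
    intro t
    have h1 := conjugate_parabolic_nonneg (deriv q t) (hne t)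
    rw [hH, hE] at h1
    by_contra! hlt
    have hη : 0 < ‖q t‖ - (q t).re := lt_of_le_of_lt (by positivity) hlt
    have h2 := nonneg_of_mul_nonneg_right h1 hη
    have h3 : (b ^ 2 / 2 - 1 / a - a) * (‖q t‖ - (q t).re) ≤ 0 := by
      refine mul_nonpos_of_nonpos_of_nonneg ?_ hη.le
      have : 2 / a = 2 * (1 / a) := by ring
      linarith
    have h4 : 0 ≤ a * b ^ 2 := by positivity
    nlinarith
  refine (Metric.isBounded_closedBall (x := (0 : ℂ)) (r := 2 * a + 2 * a * b ^ 2 + 1)).subset ?_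
  rintro _ ⟨t, rfl⟩
  rw [mem_closedBall_zero_iff]
  have := norm_nonneg (q t)
  linarith [hle t, hconj t]

end IsStarkSolutionFrom

/-! ### Bounded solutions avoiding the negative axis -/

lemma parabolic_pos_of_avoids {q : ℝ → ℂ} (h : AvoidsNegativeAxis q) (t : ℝ) :
    0 < ‖q t‖ + (q t).re := by
  refine lt_of_le_of_ne (parabolic_nonneg _) fun h0 => h t ?_
  have h1 := sq_norm_eq (q t)
  have h2 := norm_nonneg (q t)
  have h3 : ‖q t‖ = -(q t).re := by linarith
  rw [h3] at h1 h2
  exact ⟨by nlinarith, by linarith⟩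

/-- The initial velocity of a bounded solution that starts at `(a, 0)` and avoids the negative
axis. -/
lemma IsStarkSolution.isStarkSolutionFrom_of_avoids {a : ℝ} (ha : 0 < a)
    {q : ℝ → ℂ} (hq : IsStarkSolution q) (h0 : q 0 = a)
    (hb : Bornology.IsBounded (Set.range q)) (hav : AvoidsNegativeAxis q) :
    IsStarkSolutionFrom a (√(2 / a - 2 * a)) q ∨ IsStarkSolutionFrom a (-√(2 / a - 2 * a)) q := by
  obtain ⟨h1, h2⟩ := hq.parabolic_eq_neg_energy (parabolic_pos_of_avoids hav) hb 0
  have hne : q 0 ≠ 0 := ne_zero_of_parabolic_pos (parabolic_pos_of_avoids hav 0)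
  have hd := hq.hasDerivAt hne
  have hn := sq_norm_eq (deriv q 0)
  simp only [parabolicSpeed, starkEnergy, h0, hn] at h1 h2
  simp [abs_of_pos ha] at h1 h2
  have hX : (deriv q 0).re = 0 := by
    rcases h1 with h1 | h1
    · linarith
    · exact h1
  have hY : (deriv q 0).im ^ 2 = 2 / a - 2 * a := by
    rw [hX] at h2
    field_simp at h2 ⊢
    linarith
  have habs : |(deriv q 0).im| = √(2 / a - 2 * a) := by rw [← hY, Real.sqrt_sq_eq_abs]
  have hd' : deriv q 0 = ((deriv q 0).im : ℂ) * Complex.I := by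
    apply Complex.ext <;> simp [hX]
  rw [hd'] at hd
  rcases abs_cases (deriv q 0).im with ⟨h, _⟩ | ⟨h, _⟩
  · left; rw [← habs, h]; exact ⟨hq, h0, hd⟩
  · right; rw [← habs, h, neg_neg]; exact ⟨hq, h0, hd⟩

/-! ### Inverse functions on the line -/

/-- `F` is physical time as a function of regularized time, or a quadrature. Zeros of `f` are
allowed because `dt/dτ` vanishes at collisions. -/
lemma exists_continuous_inverse {F f : ℝ → ℝ} (hF : ∀ x, HasDerivAt F (f x) x)
    (hmono : StrictMono F) (htop : Tendsto F atTop atTop) (hbot : Tendsto F atBot atBot) :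
    ∃ σ : ℝ → ℝ, (∀ t, F (σ t) = t) ∧ (∀ x, σ (F x) = x) ∧ Continuous σ ∧
      ∀ t, f (σ t) ≠ 0 → HasDerivAt σ (f (σ t))⁻¹ t := by
  have hc : Continuous F := continuous_iff_continuousAt.2 fun x => (hF x).continuousAt
  let e := hmono.orderIsoOfSurjective F (hc.surjective htop hbot)
  have h1 : ∀ t, F (e.symm t) = t := e.apply_symm_apply
  refine ⟨e.symm, h1, e.symm_apply_apply, e.symm.continuous, fun t ht => ?_⟩
  exact HasDerivAt.of_local_left_inverse e.symm.continuous.continuousAt (hF _) ht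
    (Eventually.of_forall h1)

lemma strictMono_and_tendsto_of_deriv_ge {F f : ℝ → ℝ} (hF : ∀ x, HasDerivAt F (f x) x) {m : ℝ}
    (hm : 0 < m) (hf : ∀ x, m ≤ f x) :
    StrictMono F ∧ Tendsto F atTop atTop ∧ Tendsto F atBot atBot := by
  have key : ∀ x y, x ≤ y → m * (y - x) ≤ F y - F x := fun x y hxy =>
    mul_sub_le_sub_of_hasDerivAt hxy (fun t _ => hF t) (fun t _ => hf t)
  refine ⟨fun x y hxy => ?_, ?_, ?_⟩
  · have := key x y hxy.le
    have : 0 < m * (y - x) := mul_pos hm (by linarith)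
    linarith
  · refine tendsto_atTop_mono' _ (f₁ := fun x => m * x + F 0) ?_
      (tendsto_atTop_add_const_right _ _ (tendsto_id.const_mul_atTop hm))
    filter_upwards [eventually_ge_atTop 0] with x hx
    have := key 0 x hx
    linarith
  · refine tendsto_atBot_mono' _ (f₁ := fun x => m * x + F 0) ?_
      (tendsto_atBot_add_const_right _ _ (tendsto_id.const_mul_atBot hm))
    filter_upwards [eventually_le_atBot 0] with x hx
    have := key x 0 hx
    linarith

/-! ### Levi-Civita regularization -/

/-- For `q = z² / 2` and `dt = |z|² dτ`, the velocity is `z z' / |z|² = z' / conj z`. -/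
lemma hasDerivAt_leviCivita {u v σ : ℝ → ℝ} {u' v' t : ℝ} (hu : HasDerivAt u u' (σ t))
    (hv : HasDerivAt v v' (σ t)) (hz : u (σ t) ^ 2 + v (σ t) ^ 2 ≠ 0)
    (hσ : HasDerivAt σ (u (σ t) ^ 2 + v (σ t) ^ 2)⁻¹ t) :
    HasDerivAt (fun t => ((u (σ t) : ℂ) + v (σ t) * Complex.I) ^ 2 / 2)
      (((u' : ℂ) + v' * Complex.I) / ((u (σ t) : ℂ) - v (σ t) * Complex.I)) t := by
  have h1 := (hu.comp t hσ).ofReal_comp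
  have h2 := (hv.comp t hσ).ofReal_comp
  refine (((h1.add (h2.mul_const Complex.I)).pow 2).div_const 2).congr_deriv ?_
  have hN : ((u (σ t) : ℂ) ^ 2 + (v (σ t) : ℂ) ^ 2) ≠ 0 := by exact_mod_cast hz
  have hN' : ((u (σ t) : ℂ) ^ 2 + (v (σ t) : ℂ) ^ 2) =
      ((u (σ t) : ℂ) + v (σ t) * Complex.I) * ((u (σ t) : ℂ) - v (σ t) * Complex.I) := by
    linear_combination ((v (σ t) : ℂ) ^ 2) * Complex.I_sq
  have hw : (u (σ t) : ℂ) - v (σ t) * Complex.I ≠ 0 := right_ne_zero_of_mul (hN' ▸ hN)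
  have hz' : (u (σ t) : ℂ) + v (σ t) * Complex.I ≠ 0 := left_ne_zero_of_mul (hN' ▸ hN)
  simp only [Pi.add_apply, Function.comp_apply]
  push_cast
  rw [hN']
  field_simp

lemma leviCivita_ne_zero {u v : ℝ} : ((u : ℂ) + v * Complex.I) ^ 2 / 2 ≠ 0 ↔
    u ^ 2 + v ^ 2 ≠ 0 := by
  have : ((u : ℂ) + v * Complex.I) ^ 2 / 2 = 0 ↔ u ^ 2 + v ^ 2 = 0 := by
    simp only [div_eq_zero_iff, pow_eq_zero_iff, ne_eq, OfNat.ofNat_ne_zero, not_false_eq_true,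
      or_false, Complex.ext_iff]
    simp
    constructor
    · rintro ⟨rfl, rfl⟩; simp
    · intro h; constructor <;> nlinarith [sq_nonneg u, sq_nonneg v]
  exact this.not

lemma norm_leviCivita (u v : ℝ) :
    ‖((u : ℂ) + v * Complex.I) ^ 2 / 2‖ = (u ^ 2 + v ^ 2) / 2 := by
  rw [norm_div, norm_pow, sq_norm_eq]
  simp

lemma re_leviCivita (u v : ℝ) :
    (((u : ℂ) + v * Complex.I) ^ 2 / 2).re = (u ^ 2 - v ^ 2) / 2 := by
  have : ((u : ℂ) + v * Complex.I) ^ 2 / 2 =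
      (((u ^ 2 - v ^ 2) / 2 : ℝ) : ℂ) + ((u * v : ℝ) : ℂ) * Complex.I := by
    push_cast
    linear_combination ((v : ℂ) ^ 2 / 2) * Complex.I_sq
  rw [this, Complex.add_re, Complex.ofReal_re, Complex.re_ofReal_mul, Complex.I_re, mul_zero,
    add_zero]

/-- Differentiating `z' / conj z` leaves a term in `|z'|²`; `henergy` turns it into the Kepler
force. The equations say nothing about physical time at a collision, hence the separate assumption
`hcoll`. -/
lemma isStarkSolution_leviCivita {u v u' v' σ : ℝ → ℝ} {H : ℝ}
    (hu : ∀ τ, HasDerivAt u (u' τ) τ) (hv : ∀ τ, HasDerivAt v (v' τ) τ)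
    (hu' : ∀ τ, HasDerivAt u' (2 * H * u τ + 2 * u τ ^ 3) τ)
    (hv' : ∀ τ, HasDerivAt v' (2 * H * v τ - 2 * v τ ^ 3) τ)
    (henergy : ∀ τ, u' τ ^ 2 + v' τ ^ 2 = 4 + 2 * H * (u τ ^ 2 + v τ ^ 2) + u τ ^ 4 - v τ ^ 4)
    (hσc : Continuous σ)
    (hσ : ∀ t, u (σ t) ^ 2 + v (σ t) ^ 2 ≠ 0 → HasDerivAt σ (u (σ t) ^ 2 + v (σ t) ^ 2)⁻¹ t)
    {q : ℝ → ℂ} (hq : q = fun t => ((u (σ t) : ℂ) + v (σ t) * Complex.I) ^ 2 / 2)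
    (hcoll : ∀ t₀, q t₀ = 0 → (∀ t, t ≠ t₀ → q t ≠ 0) ∧ ∀ s, q (t₀ + s) = q (t₀ - s)) :
    IsStarkSolution q := by
  have hne : ∀ t, q t ≠ 0 ↔ u (σ t) ^ 2 + v (σ t) ^ 2 ≠ 0 := fun t => by
    rw [hq]; exact leviCivita_ne_zero
  have hd : ∀ t, q t ≠ 0 → HasDerivAt q
      (((u' (σ t) : ℂ) + v' (σ t) * Complex.I) / ((u (σ t) : ℂ) - v (σ t) * Complex.I)) t := by
    intro t ht
    rw [hq]
    exact hasDerivAt_leviCivita (hu _) (hv _) ((hne t).1 ht) (hσ t ((hne t).1 ht))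
  have hcu : Continuous u := continuous_iff_continuousAt.2 fun x => (hu x).continuousAt
  have hcv : Continuous v := continuous_iff_continuousAt.2 fun x => (hv x).continuousAt
  have hcont : Continuous q := by rw [hq]; fun_prop
  refine ⟨hcont, fun t ht => (hd t ht).differentiableAt, fun t ht => ?_, fun t₀ h => ?_,
    fun t₀ h => (hcoll t₀ h).2⟩
  · have hz := (hne t).1 ht
    have he : deriv q =ᶠ[𝓝 t] fun t =>
        ((u' (σ t) : ℂ) + v' (σ t) * Complex.I) / ((u (σ t) : ℂ) - v (σ t) * Complex.I) := by
      filter_upwards [hcont.continuousAt.eventually_ne ht] with s hs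
      exact (hd s hs).deriv
    refine HasDerivAt.congr_of_eventuallyEq ?_ he
    have h1 := ((hu _).comp t (hσ t hz)).ofReal_comp
    have h2 := ((hv _).comp t (hσ t hz)).ofReal_comp
    have h3 := ((hu' _).comp t (hσ t hz)).ofReal_comp
    have h4 := ((hv' _).comp t (hσ t hz)).ofReal_comp
    have hN : ((u (σ t) : ℂ) ^ 2 + (v (σ t) : ℂ) ^ 2) ≠ 0 := by exact_mod_cast hz
    have hN' : ((u (σ t) : ℂ) ^ 2 + (v (σ t) : ℂ) ^ 2) =
        ((u (σ t) : ℂ) + v (σ t) * Complex.I) * ((u (σ t) : ℂ) - v (σ t) * Complex.I) := by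
      linear_combination ((v (σ t) : ℂ) ^ 2) * Complex.I_sq
    have hw : (u (σ t) : ℂ) - v (σ t) * Complex.I ≠ 0 := right_ne_zero_of_mul (hN' ▸ hN)
    have hz' : (u (σ t) : ℂ) + v (σ t) * Complex.I ≠ 0 := left_ne_zero_of_mul (hN' ▸ hN)
    refine ((h3.add (h4.mul_const Complex.I)).div (h1.sub (h2.mul_const Complex.I))
      hw).congr_deriv ?_
    have hE : (u' (σ t) : ℂ) ^ 2 + (v' (σ t) : ℂ) ^ 2 = 4 + 2 * H *
        ((u (σ t) : ℂ) ^ 2 + (v (σ t) : ℂ) ^ 2) + (u (σ t) : ℂ) ^ 4 - (v (σ t) : ℂ) ^ 4 := by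
      exact_mod_cast henergy (σ t)
    have hnorm : ‖q t‖ = (u (σ t) ^ 2 + v (σ t) ^ 2) / 2 := by
      rw [hq]; exact norm_leviCivita _ _
    simp only [Pi.add_apply, Pi.sub_apply, Function.comp_apply, starkForce, hnorm]
    rw [hq]
    push_cast
    have hI := Complex.I_sq
    generalize (u (σ t) : ℂ) = u at *
    generalize (v (σ t) : ℂ) = v at *
    generalize (u' (σ t) : ℂ) = u' at *
    generalize (v' (σ t) : ℂ) = v' at *
    generalize (H : ℂ) = H at *
    generalize Complex.I = i at *
    rw [hN']
    field_simp
    grind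
  · filter_upwards [self_mem_nhdsWithin] with t ht
    exact (hcoll t₀ h).1 t ht

/-! ### Motion of the second regularized coordinate -/

/-- `V` is the second regularized coordinate on the parabola `‖q‖ + q.re = 2 a`, with derivative
`V'`, starting on the axis. -/
structure IsTransverseMotion (a : ℝ) (V V' : ℝ → ℝ) : Prop where
  zero : V 0 = 0
  hasDerivAt : ∀ τ, HasDerivAt V (V' τ) τ
  hasDerivAt' : ∀ τ, HasDerivAt V' (-4 * a * V τ - 2 * V τ ^ 3) τ
  energy : ∀ τ, V' τ ^ 2 = 4 - (2 * a + V τ ^ 2) ^ 2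

/-- The energy relation factors as `V'² = (c² - V²) (2 + 2 a + V²)` with `c² = 2 - 2 a`. Putting `V
= c sin θ` removes the turning points and leaves `θ' = g θ` with `g > 0`, solved by a quadrature.
For `a = 1` the motion degenerates to `V = 0`. -/
lemma exists_transverseMotion {a : ℝ} (ha : 0 < a) (ha1 : a ≤ 1) :
    ∃ V V' : ℝ → ℝ, IsTransverseMotion a V V' ∧ 0 ≤ V' 0 ∧ (∃ τ, 0 < τ ∧ V' τ = 0) ∧
      (a < 1 → ∃ s : ℕ → ℝ, (∀ n, V (s n) ≠ 0) ∧ ∀ m n, m ≠ n → V (s m) ^ 2 ≠ V (s n) ^ 2) := by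
  set c := √(2 - 2 * a) with hc
  have hc0 : 0 ≤ c := Real.sqrt_nonneg _
  have hc2 : c ^ 2 = 2 - 2 * a := Real.sq_sqrt (by linarith)
  set g : ℝ → ℝ := fun θ => √(2 + 2 * a + c ^ 2 * Real.sin θ ^ 2) with hg
  have hpos : ∀ θ, 0 < 2 + 2 * a + c ^ 2 * Real.sin θ ^ 2 := fun θ => by positivity
  have hg0 : ∀ θ, 0 < g θ := fun θ => Real.sqrt_pos.2 (hpos θ)
  have hgsq : ∀ θ, g θ ^ 2 = 2 + 2 * a + c ^ 2 * Real.sin θ ^ 2 := fun θ =>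
    Real.sq_sqrt (hpos θ).le
  -- This gives `F' ≥ 1 / 2`, so that `F` maps onto the whole line.
  have hg2 : ∀ θ, g θ ≤ 2 := fun θ => by
    have := Real.sin_sq_le_one θ
    have : g θ ^ 2 ≤ 2 ^ 2 := by
      rw [hgsq, hc2]; nlinarith
    exact abs_le_of_sq_le_sq' this (by norm_num) |>.2
  have hgc : Continuous g := by fun_prop
  have hic : Continuous fun θ => (g θ)⁻¹ := hgc.inv₀ fun θ => (hg0 θ).ne'
  set F : ℝ → ℝ := fun θ => ∫ x in (0 : ℝ)..θ, (g x)⁻¹ with hF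
  have hF' : ∀ θ, HasDerivAt F (g θ)⁻¹ θ := fun θ =>
    intervalIntegral.integral_hasDerivAt_right (hic.intervalIntegrable _ _)
      (hic.stronglyMeasurableAtFilter _ _) hic.continuousAt
  obtain ⟨hm, ht, hb⟩ := strictMono_and_tendsto_of_deriv_ge hF' (m := 1 / 2) (by norm_num)
    fun θ => by
      have := hg0 θ
      rw [one_div]
      gcongr
      exact hg2 θ
  obtain ⟨Θ, hFΘ, hΘF, -, hΘ⟩ := exists_continuous_inverse hF' hm ht hb
  have hΘ' : ∀ τ, HasDerivAt Θ (g (Θ τ)) τ := fun τ => by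
    simpa using hΘ τ (by simpa using (hg0 _).ne')
  have hF0 : F 0 = 0 := by simp [hF]
  have hΘ0 : Θ 0 = 0 := by simpa only [hF0] using hΘF 0
  refine ⟨fun τ => c * Real.sin (Θ τ), fun τ => c * (Real.cos (Θ τ) * g (Θ τ)),
    ⟨by simp [hΘ0], fun τ => (hΘ' τ).sin.const_mul c, fun τ => ?_, fun τ => ?_⟩, ?_, ?_, ?_⟩
  · have h1 : HasDerivAt (fun τ => g (Θ τ))
        (c ^ 2 * Real.sin (Θ τ) * Real.cos (Θ τ)) τ := by
      refine HasDerivAt.congr_deriv (((((hΘ' τ).sin.pow 2).const_mul (c ^ 2)).const_add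
        (2 + 2 * a)).sqrt (hpos _).ne') ?_
      have := (hg0 (Θ τ)).ne'
      change _ / (2 * g (Θ τ)) = _
      field_simp
      norm_num
      ring
    refine (((hΘ' τ).cos.mul h1).const_mul c).congr_deriv ?_
    have h2 := hgsq (Θ τ)
    have h3 := Real.sin_sq_add_cos_sq (Θ τ)
    generalize g (Θ τ) = G at *
    generalize Real.sin (Θ τ) = S at *
    generalize Real.cos (Θ τ) = C at *
    grind
  · have h2 := hgsq (Θ τ)
    have h3 := Real.sin_sq_add_cos_sq (Θ τ)
    generalize g (Θ τ) = G at *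
    generalize Real.sin (Θ τ) = S at *
    generalize Real.cos (Θ τ) = C at *
    grind
  · simp only [hΘ0, Real.cos_zero, one_mul]
    have := hg0 0
    positivity
  · refine ⟨F (Real.pi / 2), ?_, by simp [hΘF]⟩
    simpa only [hF0] using hm (show (0 : ℝ) < Real.pi / 2 by positivity)
  · intro h1
    have hcp : 0 < c := Real.sqrt_pos.2 (by linarith)
    have hI : ∀ n : ℕ, 0 < 1 / ((n : ℝ) + 1) ∧ 1 / ((n : ℝ) + 1) ≤ 1 := fun n =>
      ⟨by positivity, by rw [div_le_one (by positivity)]; linarith [Nat.cast_nonneg (α := ℝ) n]⟩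
    have hpi := Real.pi_gt_three
    have hs : ∀ n : ℕ, 0 < Real.sin (1 / ((n : ℝ) + 1)) := fun n =>
      Real.sin_pos_of_pos_of_lt_pi (hI n).1 (by linarith [(hI n).2])
    -- These are the times when `θ = 1 / (n + 1)`, in a range where the sine is positive and
    -- injective.
    refine ⟨fun n => F (1 / (n + 1)), fun n => ?_, fun m n hmn h => hmn ?_⟩
    · simp only [hΘF]
      exact (mul_pos hcp (hs n)).ne'
    · simp only [hΘF] at h
      rw [sq_eq_sq₀ (mul_pos hcp (hs m)).le (mul_pos hcp (hs n)).le] at h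
      have h2 := mul_left_cancel₀ hcp.ne' h
      have h3 := Real.injOn_sin ⟨by linarith [(hI m).1], by linarith [(hI m).2]⟩
        ⟨by linarith [(hI n).1], by linarith [(hI n).2]⟩ h2
      simpa using h3

/-! ### The orbit on the parabola -/

/-- At rest, reversing time does not change the initial data. -/
lemma IsStarkSolution.reflect_of_deriv_eq_zero {q : ℝ → ℂ} (hq : IsStarkSolution q) {t : ℝ}
    (hne : q t ≠ 0) (hd : deriv q t = 0) (s : ℝ) : q (t + s) = q (t - s) := by
  have h1 := hq.comp_add t
  have e1 : deriv (fun s => q (s + t)) 0 = 0 := by rw [deriv_comp_add_const, zero_add, hd]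
  have e2 : deriv (fun s => q (-s + t)) 0 = 0 := by
    rw [deriv_comp_neg (fun s => q (s + t)) 0, neg_zero, e1, neg_zero]
  have := congrFun (h1.eq_of_eq h1.comp_neg (by simp) (by simpa using hne) (e1.trans e2.symm)) s
  rw [add_comm]
  refine this.trans ?_
  congr 1
  ring

/-- Uniform continuity lets a vanishing error in time be absorbed when comparing with the parabolic
orbit. -/
lemma uniformContinuous_of_periodic_deriv {f : ℝ → ℂ} (hf : Differentiable ℝ f)
    (hc : Continuous (deriv f)) {c : ℝ} (hp : Function.Periodic (deriv f) c) (h0 : c ≠ 0) :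
    UniformContinuous f := by
  obtain ⟨C, hC0, hC⟩ := (hp.isBounded_of_continuous h0 hc).exists_pos_norm_le
  refine (lipschitzWith_of_nnnorm_deriv_le (C := ⟨C, hC0.le⟩) hf fun x => ?_).uniformContinuous
  exact hC _ ⟨x, rfl⟩

lemma Function.Periodic.deriv_of_real {f : ℝ → ℂ} {c : ℝ} (hf : Function.Periodic f c) :
    Function.Periodic (deriv f) c := by
  intro x
  rw [← deriv_comp_add_const, funext hf]

/-- `T` is the physical time along the parabola as a function of the regularized time, and `σ` is
its inverse. -/
structure IsRegularizedTime (a : ℝ) (V T σ : ℝ → ℝ) : Prop where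
  zero : T 0 = 0
  hasDerivAt : ∀ τ, HasDerivAt T (2 * a + V τ ^ 2) τ
  right_inv : ∀ t, T (σ t) = t
  left_inv : ∀ τ, σ (T τ) = τ
  continuous_symm : Continuous σ
  hasDerivAt_symm : ∀ t, HasDerivAt σ (2 * a + V (σ t) ^ 2)⁻¹ t
  strictMono : StrictMono T
  tendsto_atTop : Tendsto T atTop atTop
  tendsto_atBot : Tendsto T atBot atBot

/-- The motion along the parabola `‖q‖ + q.re = 2 a`. -/
noncomputable def parabolicOrbit (a : ℝ) (V σ : ℝ → ℝ) (t : ℝ) : ℂ :=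
  (((√(2 * a) : ℝ) : ℂ) + (V (σ t) : ℂ) * Complex.I) ^ 2 / 2

namespace IsTransverseMotion

variable {a : ℝ} {V V' : ℝ → ℝ}

lemma continuous (hV : IsTransverseMotion a V V') : Continuous V :=
  continuous_iff_continuousAt.2 fun x => (hV.hasDerivAt x).continuousAt

lemma sq_le (hV : IsTransverseMotion a V V') (ha : 0 < a) (τ : ℝ) : V τ ^ 2 ≤ 2 - 2 * a := by
  have h1 := hV.energy τ
  have h2 := sq_nonneg (V' τ)
  nlinarith [sq_nonneg (V τ)]

lemma abs_le (hV : IsTransverseMotion a V V') (ha : 0 < a) (τ : ℝ) : |V τ| ≤ 2 := by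
  have := hV.sq_le ha τ
  exact abs_le_of_sq_le_sq (by nlinarith) (by norm_num)

lemma abs_deriv_le (hV : IsTransverseMotion a V V') (τ : ℝ) : |V' τ| ≤ 2 := by
  have := hV.energy τ
  exact abs_le_of_sq_le_sq (by nlinarith [sq_nonneg (2 * a + V τ ^ 2)]) (by norm_num)

lemma exists_regularizedTime (hV : IsTransverseMotion a V V') (ha : 0 < a) :
    ∃ T σ, IsRegularizedTime a V T σ := by
  have hVc := hV.continuous
  have hc : Continuous fun τ => 2 * a + V τ ^ 2 := by fun_prop
  have hT : ∀ τ, HasDerivAt (fun τ => ∫ x in (0 : ℝ)..τ, (2 * a + V x ^ 2)) (2 * a + V τ ^ 2) τ :=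
    fun τ => intervalIntegral.integral_hasDerivAt_right (hc.intervalIntegrable _ _)
      (hc.stronglyMeasurableAtFilter _ _) hc.continuousAt
  obtain ⟨hm, ht, hb⟩ := strictMono_and_tendsto_of_deriv_ge hT (m := 2 * a) (by positivity)
    fun τ => by nlinarith [sq_nonneg (V τ)]
  obtain ⟨σ, h1, h2, h3, h4⟩ := exists_continuous_inverse hT hm ht hb
  exact ⟨_, σ, by simp, hT, h1, h2, h3, fun t => h4 t (by positivity), hm, ht, hb⟩

variable {T σ : ℝ → ℝ}

lemma sq_sqrt_two_mul (ha : 0 < a) : √(2 * a) ^ 2 = 2 * a := Real.sq_sqrt (by positivity)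

lemma parabolicOrbit_ne_zero (ha : 0 < a) (t : ℝ) : parabolicOrbit a V σ t ≠ 0 := by
  refine leviCivita_ne_zero.2 ?_
  rw [sq_sqrt_two_mul ha]
  positivity

lemma norm_parabolicOrbit (ha : 0 < a) (t : ℝ) :
    ‖parabolicOrbit a V σ t‖ = (2 * a + V (σ t) ^ 2) / 2 := by
  rw [parabolicOrbit, norm_leviCivita, sq_sqrt_two_mul ha]

lemma re_parabolicOrbit (ha : 0 < a) (t : ℝ) :
    (parabolicOrbit a V σ t).re = (2 * a - V (σ t) ^ 2) / 2 := by
  rw [parabolicOrbit, re_leviCivita, sq_sqrt_two_mul ha]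

lemma hasDerivAt_parabolicOrbit (hV : IsTransverseMotion a V V') (ha : 0 < a)
    (hT : IsRegularizedTime a V T σ) (t : ℝ) :
    HasDerivAt (parabolicOrbit a V σ)
      ((V' (σ t) * Complex.I) / (((√(2 * a) : ℝ) : ℂ) - V (σ t) * Complex.I)) t := by
  have h2a := sq_sqrt_two_mul ha
  have := hasDerivAt_leviCivita (u := fun _ => √(2 * a)) (v := V) (σ := σ) (t := t)
    (hasDerivAt_const _ _) (hV.hasDerivAt _) (by rw [h2a]; positivity)
    (by rw [h2a]; exact hT.hasDerivAt_symm t)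
  simp only [Complex.ofReal_zero, zero_add] at this
  exact this

lemma isStarkSolution_parabolicOrbit (hV : IsTransverseMotion a V V') (ha : 0 < a)
    (hT : IsRegularizedTime a V T σ) : IsStarkSolution (parabolicOrbit a V σ) := by
  have h2a := sq_sqrt_two_mul ha
  -- The value `H = -2 a` is the one for which `u = √(2 a)` is an equilibrium of `u'' = 2 H u + 2
  -- u³`.
  refine isStarkSolution_leviCivita (u := fun _ => √(2 * a)) (u' := fun _ => 0) (v := V)
    (H := -(2 * a)) (fun τ => hasDerivAt_const _ _) hV.hasDerivAt (fun τ => ?_) (fun τ => ?_)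
    (fun τ => ?_) hT.continuous_symm (fun t _ => ?_) rfl
    (fun t h => absurd h (parabolicOrbit_ne_zero ha t))
  · refine (hasDerivAt_const τ (0 : ℝ)).congr_deriv ?_
    linear_combination (-2 * √(2 * a)) * h2a
  · exact (hV.hasDerivAt' τ).congr_deriv (by ring)
  · have h4 : √(2 * a) ^ 4 = (2 * a) ^ 2 := by linear_combination (√(2 * a) ^ 2 + 2 * a) * h2a
    rw [h4, h2a, hV.energy]
    ring
  · simp only [h2a]
    exact hT.hasDerivAt_symm t

lemma isStarkSolutionFrom_parabolicOrbit (hV : IsTransverseMotion a V V') (ha : 0 < a)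
    (hV0 : 0 ≤ V' 0) (hT : IsRegularizedTime a V T σ) :
    IsStarkSolutionFrom a (√(2 / a - 2 * a)) (parabolicOrbit a V σ) := by
  have h2a := sq_sqrt_two_mul ha
  have hA : 0 < √(2 * a) := Real.sqrt_pos.2 (by positivity)
  have hσ0 : σ 0 = 0 := by simpa only [hT.zero] using hT.left_inv 0
  refine ⟨hV.isStarkSolution_parabolicOrbit ha hT, ?_, ?_⟩
  · rw [parabolicOrbit, hσ0, hV.zero, Complex.ofReal_zero, zero_mul, add_zero, ← Complex.ofReal_pow,
      h2a]
    push_cast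
    ring
  · have := hV.hasDerivAt_parabolicOrbit ha hT 0
    rw [hσ0, hV.zero, Complex.ofReal_zero, zero_mul, sub_zero] at this
    have hb : √(2 / a - 2 * a) = V' 0 / √(2 * a) := by
      have h1 : 2 / a - 2 * a = (V' 0 / √(2 * a)) ^ 2 := by
        rw [div_pow, h2a, hV.energy, hV.zero]
        field_simp
        ring
      rw [h1, Real.sqrt_sq (by positivity)]
    rw [hb]
    refine this.congr_deriv ?_
    push_cast
    ring

/-- After half a period the orbit on the parabola is reflected in the axis. -/
lemma exists_parabolicOrbit_add (hV : IsTransverseMotion a V V') (ha : 0 < a)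
    (hV0 : 0 ≤ V' 0) (hbrake : ∃ τ, 0 < τ ∧ V' τ = 0) (hT : IsRegularizedTime a V T σ) :
    ∃ d, 0 < d ∧ ∀ t, parabolicOrbit a V σ (t + d) = conj (parabolicOrbit a V σ t) := by
  obtain ⟨τ, hτ, hτ0⟩ := hbrake
  have hpos : 0 < T τ := by simpa only [hT.zero] using hT.strictMono hτ
  have hfrom := hV.isStarkSolutionFrom_parabolicOrbit ha hV0 hT
  refine ⟨2 * T τ, by positivity, fun t => ?_⟩
  have hd : deriv (parabolicOrbit a V σ) (T τ) = 0 := by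
    rw [(hV.hasDerivAt_parabolicOrbit ha hT _).deriv, hT.left_inv, hτ0]
    simp
  -- Reversal about the brake time `T τ`, followed by reversal about `0`, is translation by `2 T τ`;
  -- the second reversal is a conjugation.
  have := hfrom.1.reflect_of_deriv_eq_zero (parabolicOrbit_ne_zero ha _) hd (t + T τ)
  rw [← hfrom.neg_eq_conj ha.ne', show t + 2 * T τ = T τ + (t + T τ) by ring, this]
  congr 1
  ring

end IsTransverseMotion

/-! ### Homoclinic orbits -/

/-- The heteroclinic motion of the first regularized coordinate between its unstable equilibria
`-A` and `A`, that is `A tanh (A τ)`. -/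
noncomputable def kink (A τ : ℝ) : ℝ := A * (1 - 2 / (Real.exp (2 * A * τ) + 1))

lemma hasDerivAt_kink (A τ : ℝ) : HasDerivAt (kink A) (A ^ 2 - kink A τ ^ 2) τ := by
  have h0 : Real.exp (2 * A * τ) + 1 ≠ 0 := by positivity
  have h1 : HasDerivAt (fun τ => Real.exp (2 * A * τ)) (Real.exp (2 * A * τ) * (2 * A)) τ := by
    simpa using ((hasDerivAt_id τ).const_mul (2 * A)).exp
  refine (((((h1.add_const 1).inv h0).const_mul 2).const_sub 1).const_mul A).congr_deriv ?_
  simp only [kink]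
  field_simp
  ring

lemma kink_neg (A τ : ℝ) : kink A (-τ) = -kink A τ := by
  have h0 : Real.exp (2 * A * τ) + 1 ≠ 0 := by positivity
  simp only [kink, mul_neg, Real.exp_neg]
  field_simp
  ring

lemma kink_zero (A : ℝ) : kink A 0 = 0 := by simp [kink]; norm_num

lemma kink_eq_zero_iff {A τ : ℝ} (hA : 0 < A) : kink A τ = 0 ↔ τ = 0 := by
  refine ⟨fun h => ?_, fun h => h ▸ kink_zero A⟩
  have h0 : Real.exp (2 * A * τ) + 1 ≠ 0 := by positivity
  rw [kink, mul_eq_zero, or_iff_right hA.ne', sub_eq_zero, eq_div_iff h0] at h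
  have h1 : Real.exp (2 * A * τ) = 1 := by linarith
  rw [Real.exp_eq_one_iff, mul_eq_zero, or_iff_right (by positivity)] at h1
  exact h1

lemma tendsto_kink_atTop {A : ℝ} (hA : 0 < A) : Tendsto (kink A) atTop (𝓝 A) := by
  have h1 : Tendsto (fun τ => Real.exp (2 * A * τ) + 1) atTop atTop :=
    tendsto_atTop_add_const_right _ _ (Real.tendsto_exp_atTop.comp
      (tendsto_id.const_mul_atTop (by positivity)))
  have h2 := ((h1.const_div_atTop 2).const_sub 1).const_mul A
  rw [sub_zero, mul_one] at h2
  exact h2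

lemma tendsto_kink_atBot {A : ℝ} (hA : 0 < A) : Tendsto (kink A) atBot (𝓝 (-A)) := by
  have := ((tendsto_kink_atTop hA).comp tendsto_neg_atBot_atTop).neg
  refine this.congr fun τ => ?_
  simp [kink_neg]

lemma abs_kink_le {A : ℝ} (hA : 0 < A) (τ : ℝ) : |kink A τ| ≤ A := by
  have h0 : 0 < Real.exp (2 * A * τ) := Real.exp_pos _
  have h1 : 2 / (Real.exp (2 * A * τ) + 1) ≤ 2 := by
    rw [div_le_iff₀ (by positivity)]; linarith
  have h2 : 0 ≤ 2 / (Real.exp (2 * A * τ) + 1) := by positivity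
  rw [kink, abs_mul, abs_of_pos hA]
  refine mul_le_of_le_one_right hA.le ?_
  rw [_root_.abs_le]
  constructor <;> linarith

lemma UniformContinuous.tendsto_sub {ι : Type*} {l : Filter ι} {f : ℝ → ℂ}
    (hf : UniformContinuous f) {x y : ι → ℝ} (h : Tendsto (fun i => x i - y i) l (𝓝 0)) :
    Tendsto (fun i => f (x i) - f (y i)) l (𝓝 0) := by
  rw [Metric.tendsto_nhds] at h ⊢
  intro ε hε
  obtain ⟨δ, hδ, hfδ⟩ := Metric.uniformContinuous_iff.1 hf ε hε
  filter_upwards [h δ hδ] with i hi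
  rw [dist_zero_right, ← dist_eq_norm]
  refine hfδ ?_
  rwa [dist_zero_right, ← dist_eq_norm] at hi

lemma tendsto_leviCivita_sub {l : Filter ℝ} {u v : ℝ → ℝ} {B C : ℝ}
    (hu : Tendsto u l (𝓝 B)) (hv : ∀ τ, |v τ| ≤ C) :
    Tendsto (fun τ => ((u τ : ℂ) + v τ * Complex.I) ^ 2 / 2 - ((B : ℂ) + v τ * Complex.I) ^ 2 / 2)
      l (𝓝 0) := by
  have h1 : Tendsto (fun τ => ((u τ ^ 2 - B ^ 2) / 2 : ℝ)) l (𝓝 0) := by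
    have := ((hu.pow 2).sub_const (B ^ 2)).div_const 2
    simpa using this
  have h2 : Tendsto (fun τ => v τ * (u τ - B)) l (𝓝 0) := by
    refine bdd_le_mul_tendsto_zero' C (Eventually.of_forall hv) ?_
    simpa using hu.sub_const B
  have h3 : Tendsto (fun τ => (((u τ ^ 2 - B ^ 2) / 2 : ℝ) : ℂ) +
      ((v τ * (u τ - B) : ℝ) : ℂ) * Complex.I) l (𝓝 (((0 : ℝ) : ℂ) + ((0 : ℝ) : ℂ) * Complex.I)) :=
    ((Complex.continuous_ofReal.tendsto 0).comp h1).add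
      (((Complex.continuous_ofReal.tendsto 0).comp h2).mul_const _)
  simp only [Complex.ofReal_zero, zero_mul, add_zero] at h3
  refine h3.congr fun τ => ?_
  push_cast
  ring

lemma abs_le_norm_sub_mul_I (x y : ℝ) : |x| ≤ ‖(x : ℂ) - y * Complex.I‖ := by
  simpa using Complex.abs_re_le_norm ((x : ℂ) - y * Complex.I)

lemma tendsto_leviCivita_deriv_sub {l : Filter ℝ} {u v u' v' : ℝ → ℝ} {B C : ℝ} (hB : B ≠ 0)
    (hu : Tendsto u l (𝓝 B)) (hu' : Tendsto u' l (𝓝 0))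
    (hv' : ∀ τ, |v' τ| ≤ C) :
    Tendsto (fun τ => ((u' τ : ℂ) + v' τ * Complex.I) / ((u τ : ℂ) - v τ * Complex.I) -
      (v' τ * Complex.I) / ((B : ℂ) - v τ * Complex.I)) l (𝓝 0) := by
  have hB0 : 0 < |B| := abs_pos.2 hB
  have h1 : ∀ᶠ τ in l, |B| / 2 < |u τ| := hu.abs.eventually_const_lt (by linarith)
  have h2 : Tendsto (fun τ => |u' τ| / (|B| / 2) + C * |B - u τ| / (|B| / 2 * |B|)) l (𝓝 0) := by
    have e1 := (hu'.abs).div_const (|B| / 2)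
    have e2 := ((((hu.const_sub B).abs).const_mul C).div_const (|B| / 2 * |B|))
    simpa using e1.add e2
  -- The denominators are bounded below by their real parts, whatever `v` is.
  refine squeeze_zero_norm' ?_ h2
  filter_upwards [h1] with τ hτ
  have d1 := abs_le_norm_sub_mul_I (u τ) (v τ)
  have d2 := abs_le_norm_sub_mul_I B (v τ)
  have n1 : (u τ : ℂ) - v τ * Complex.I ≠ 0 := norm_pos_iff.1 (by linarith)
  have n2 : (B : ℂ) - v τ * Complex.I ≠ 0 := norm_pos_iff.1 (by linarith)
  have e : ((u' τ : ℂ) + v' τ * Complex.I) / ((u τ : ℂ) - v τ * Complex.I) -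
      (v' τ * Complex.I) / ((B : ℂ) - v τ * Complex.I) =
      (u' τ : ℂ) / ((u τ : ℂ) - v τ * Complex.I) + (v' τ * Complex.I * ((B - u τ : ℝ) : ℂ)) /
        (((u τ : ℂ) - v τ * Complex.I) * ((B : ℂ) - v τ * Complex.I)) := by
    have hs : ((B - u τ : ℝ) : ℂ) =
        ((B : ℂ) - v τ * Complex.I) - ((u τ : ℂ) - v τ * Complex.I) := by push_cast; ring
    rw [hs]
    generalize (u τ : ℂ) - v τ * Complex.I = D₁ at *
    generalize (B : ℂ) - v τ * Complex.I = D₂ at *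
    field_simp
    ring
  rw [e]
  refine (norm_add_le _ _).trans ?_
  simp only [norm_div, norm_mul, Complex.norm_real, Complex.norm_I, mul_one, Real.norm_eq_abs]
  have := hv' τ
  have hC := (abs_nonneg _).trans this
  have d3 := hτ.le.trans d1
  gcongr

/-- A motion of the regularized variables that tends to the parabola is asymptotic to the motion on
the parabola. -/
lemma isAsymptoticTo_of_tendsto {l : Filter ℝ} {P Q : ℝ → ℂ} {u v u' v' T TQ σQ : ℝ → ℝ}
    {B C d e : ℝ} (hB : B ≠ 0) (hP : UniformContinuous P) (hP' : UniformContinuous (deriv P))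
    (hu : Tendsto u l (𝓝 B)) (hu' : Tendsto u' l (𝓝 0)) (hv : ∀ τ, |v τ| ≤ C)
    (hv' : ∀ τ, |v' τ| ≤ C)
    (hQ : ∀ τ, Q (TQ τ) = ((u τ : ℂ) + v τ * Complex.I) ^ 2 / 2)
    (hQ' : ∀ τ, u τ ≠ 0 → deriv Q (TQ τ) =
      ((u' τ : ℂ) + v' τ * Complex.I) / ((u τ : ℂ) - v τ * Complex.I))
    (hPT : ∀ τ, P (T τ + d) = ((B : ℂ) + v τ * Complex.I) ^ 2 / 2)
    (hPT' : ∀ τ, deriv P (T τ + d) = (v' τ * Complex.I) / ((B : ℂ) - v τ * Complex.I))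
    (hTQ : ∀ τ, TQ τ = T τ - e - u τ) (hσ : Tendsto σQ l l) (hinv : ∀ t, TQ (σQ t) = t) :
    IsAsymptoticTo Q P l := by
  -- The two clocks differ by `e + u`, which tends to `e + B`; adding `d` gives the asymptotic
  -- shift.
  have hshift : Tendsto (fun τ => (T τ + d) - (TQ τ + (e + B + d))) l (𝓝 0) := by
    have := hu.sub_const B
    rw [sub_self] at this
    refine this.congr fun τ => ?_
    rw [hTQ]; ring
  refine ⟨e + B + d, ?_, ?_⟩
  · have h1 := (tendsto_leviCivita_sub hu hv).add (hP.tendsto_sub hshift)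
    rw [add_zero] at h1
    refine (h1.comp hσ).congr fun t => ?_
    simp only [Function.comp_apply]
    rw [← hQ, hPT, hinv]
    ring
  · have h1 := (tendsto_leviCivita_deriv_sub (v := v) hB hu hu' hv').add (hP'.tendsto_sub hshift)
    rw [add_zero] at h1
    have hne : ∀ᶠ τ in l, u τ ≠ 0 := hu.eventually_ne hB
    refine (h1.comp hσ).congr' ?_
    filter_upwards [hσ.eventually hne] with t ht
    simp only [Function.comp_apply]
    rw [← hQ' _ ht, hPT', hinv]
    ring

lemma IsAsymptoticTo.comp_add_atTop {p q : ℝ → ℂ} (h : IsAsymptoticTo p q atTop) (r : ℝ) :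
    IsAsymptoticTo (fun t => p (t + r)) q atTop := by
  obtain ⟨s, h1, h2⟩ := h
  have ht : Tendsto (fun t : ℝ => t + r) atTop atTop := tendsto_atTop_add_const_right _ _ tendsto_id
  refine ⟨r + s, (h1.comp ht).congr fun t => ?_, (h2.comp ht).congr fun t => ?_⟩
  · simp [add_assoc]
  · simp [add_assoc, deriv_comp_add_const]

lemma IsAsymptoticTo.comp_add_atBot {p q : ℝ → ℂ} (h : IsAsymptoticTo p q atBot) (r : ℝ) :
    IsAsymptoticTo (fun t => p (t + r)) q atBot := by
  obtain ⟨s, h1, h2⟩ := h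
  have ht : Tendsto (fun t : ℝ => t + r) atBot atBot := tendsto_atBot_add_const_right _ _ tendsto_id
  refine ⟨r + s, (h1.comp ht).congr fun t => ?_, (h2.comp ht).congr fun t => ?_⟩
  · simp [add_assoc]
  · simp [add_assoc, deriv_comp_add_const]

namespace IsTransverseMotion

variable {a : ℝ} {V V' T σ : ℝ → ℝ}

lemma eq_zero_of_one (hV : IsTransverseMotion 1 V V') (τ : ℝ) : V τ = 0 := by
  have := hV.sq_le one_pos τ
  exact pow_eq_zero_iff two_ne_zero |>.1 (le_antisymm (by linarith) (sq_nonneg _))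

/-- The kink satisfies the `u`-equation for `H = -2 a`, so it can be paired with any time shift `s`
of `V`. It vanishes only at `τ = 0`, where the solution crosses the negative axis at distance `V s ^
2 / 2`; a collision is possible only if `V s = 0`. -/
lemma exists_homoclinic (hV : IsTransverseMotion a V V') (ha : 0 < a) (hV0 : 0 ≤ V' 0)
    (hbrake : ∃ τ, 0 < τ ∧ V' τ = 0) (hT : IsRegularizedTime a V T σ) (s : ℝ)
    (hs : V s ≠ 0 ∨ a = 1) :
    ∃ Q : ℝ → ℂ, IsStarkSolution Q ∧ (∀ t, ‖Q t‖ + (Q t).re = 0 ↔ t = 0) ∧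
      ‖Q 0‖ = V s ^ 2 / 2 ∧ IsAsymptoticTo Q (parabolicOrbit a V σ) atTop ∧
      IsAsymptoticTo Q (parabolicOrbit a V σ) atBot := by
  set A := √(2 * a) with hAdef
  have h2a : A ^ 2 = 2 * a := sq_sqrt_two_mul ha
  have hA : 0 < A := Real.sqrt_pos.2 (by positivity)
  set v : ℝ → ℝ := fun τ => V (τ + s) with hv
  set v' : ℝ → ℝ := fun τ => V' (τ + s) with hv'
  have hvd : ∀ τ, HasDerivAt v (v' τ) τ := fun τ => (hV.hasDerivAt _).comp_add_const τ s
  have hvd' : ∀ τ, HasDerivAt v' (-4 * a * v τ - 2 * v τ ^ 3) τ := fun τ =>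
    (hV.hasDerivAt' _).comp_add_const τ s
  have hvE : ∀ τ, v' τ ^ 2 = 4 - (2 * a + v τ ^ 2) ^ 2 := fun τ => hV.energy _
  have hvle : ∀ τ, |v τ| ≤ 2 := fun τ => hV.abs_le ha _
  have hvle' : ∀ τ, |v' τ| ≤ 2 := fun τ => hV.abs_deriv_le _
  have hu : ∀ τ, HasDerivAt (kink A) (A ^ 2 - kink A τ ^ 2) τ := hasDerivAt_kink A
  have hu' : ∀ τ, HasDerivAt (fun τ => A ^ 2 - kink A τ ^ 2)
      (2 * (-(2 * a)) * kink A τ + 2 * kink A τ ^ 3) τ := fun τ => by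
    refine (((hu τ).pow 2).const_sub (A ^ 2)).congr_deriv ?_
    rw [h2a]
    norm_num
    ring
  -- Physical time is explicit: `u² + v² = (A² + v²) - (A² - u²)`, and `A² - u²` is the derivative
  -- of the kink.
  set TQ : ℝ → ℝ := fun τ => T (τ + s) - T s - kink A τ with hTQ
  have hTQd : ∀ τ, HasDerivAt TQ (kink A τ ^ 2 + v τ ^ 2) τ := fun τ => by
    refine ((((hT.hasDerivAt _).comp_add_const τ s).sub_const (T s)).sub (hu τ)).congr_deriv ?_
    rw [h2a]; ring
  have hTQ0 : TQ 0 = 0 := by simp [hTQ, kink_zero]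
  have hcont : Continuous TQ := continuous_iff_continuousAt.2 fun x => (hTQd x).continuousAt
  have hpos : ∀ τ, τ ≠ 0 → 0 < kink A τ ^ 2 + v τ ^ 2 := fun τ hτ => by
    have := (kink_eq_zero_iff (τ := τ) hA).not.2 hτ
    positivity
  have hmono : StrictMono TQ := by
    -- The derivative may vanish at `τ = 0`, the collision, so the line is split there.
    refine StrictMonoOn.Iic_union_Ici (a := 0) ?_ ?_
    · refine strictMonoOn_of_deriv_pos (convex_Iic _) hcont.continuousOn fun x hx => ?_
      rw [interior_Iic] at hx
      rw [(hTQd x).deriv]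
      exact hpos x (ne_of_lt hx)
    · refine strictMonoOn_of_deriv_pos (convex_Ici _) hcont.continuousOn fun x hx => ?_
      rw [interior_Ici] at hx
      rw [(hTQd x).deriv]
      exact hpos x (ne_of_gt hx)
  have htop : Tendsto TQ atTop atTop := by
    have h1 := tendsto_atTop_add_const_right atTop (-(T s) - A)
      (hT.tendsto_atTop.comp (tendsto_atTop_add_const_right atTop s tendsto_id))
    refine tendsto_atTop_mono (fun τ => ?_) h1
    have := (_root_.abs_le.1 (abs_kink_le hA τ)).2
    simp only [hTQ, Function.comp_apply, id]
    linarith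
  have hbot : Tendsto TQ atBot atBot := by
    have h1 := tendsto_atBot_add_const_right atBot (-(T s) + A)
      (hT.tendsto_atBot.comp (tendsto_atBot_add_const_right atBot s tendsto_id))
    refine tendsto_atBot_mono (fun τ => ?_) h1
    have := (_root_.abs_le.1 (abs_kink_le hA τ)).1
    simp only [hTQ, Function.comp_apply, id]
    linarith
  obtain ⟨σQ, hr, hl, hσc, hσd⟩ := exists_continuous_inverse hTQd hmono htop hbot
  have hσ0 : ∀ t, σQ t = 0 ↔ t = 0 := fun t =>
    ⟨fun h => by rw [← hr t, h, hTQ0], fun h => by rw [h]; simpa only [hTQ0] using hl 0⟩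
  have hσtop : Tendsto σQ atTop atTop := by
    refine tendsto_atTop.2 fun b => ?_
    filter_upwards [eventually_ge_atTop (TQ b)] with t ht
    rwa [← hr t, hmono.le_iff_le] at ht
  have hσbot : Tendsto σQ atBot atBot := by
    refine tendsto_atBot.2 fun b => ?_
    filter_upwards [eventually_le_atBot (TQ b)] with t ht
    rwa [← hr t, hmono.le_iff_le] at ht
  set Q : ℝ → ℂ := fun t => ((kink A (σQ t) : ℂ) + v (σQ t) * Complex.I) ^ 2 / 2 with hQ
  have hQnorm : ∀ t, ‖Q t‖ = (kink A (σQ t) ^ 2 + v (σQ t) ^ 2) / 2 := fun t =>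
    norm_leviCivita _ _
  have hQre : ∀ t, (Q t).re = (kink A (σQ t) ^ 2 - v (σQ t) ^ 2) / 2 := fun t => re_leviCivita _ _
  have hQzero : ∀ t, Q t = 0 → t = 0 ∧ a = 1 := by
    intro t ht
    have h1 := hQnorm t
    rw [ht, norm_zero] at h1
    have h2 : σQ t = 0 := by
      by_contra h
      linarith [hpos _ h]
    rw [h2, kink_zero] at h1
    refine ⟨(hσ0 t).1 h2, hs.resolve_left fun h => ?_⟩
    have h3 : v 0 = V s := by simp [hv]
    rw [h3] at h1
    have : 0 < V s ^ 2 := by positivity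
    linarith
  have hQsol : IsStarkSolution Q := by
    refine isStarkSolution_leviCivita (u := kink A) (v := v) (v' := v') (H := -(2 * a)) hu hvd hu'
      (fun τ => (hvd' τ).congr_deriv (by ring)) (fun τ => ?_) hσc hσd rfl fun t₀ h => ?_
    · simp only [hvE, h2a]
      ring
    -- A collision occurs only for `a = 1`, where `v = 0`. Then physical time and `u` are odd in
    -- `τ`, so `q = u² / 2` is even in `t`.
    · obtain ⟨rfl, rfl⟩ := hQzero t₀ h
      refine ⟨fun t ht h0 => ht (hQzero t h0).1, fun r => ?_⟩
      have hv0 : ∀ τ, v τ = 0 := fun τ => hV.eq_zero_of_one _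
      have hodd : ∀ τ, TQ (-τ) = -TQ τ := by
        intro τ
        have h1 : ∀ τ, HasDerivAt (fun τ => TQ (-τ) + TQ τ) 0 τ := fun τ => by
          refine (((hTQd (-τ)).scomp τ (hasDerivAt_neg τ)).add (hTQd τ)).congr_deriv ?_
          simp [kink_neg, hv0]
        have h2 := is_const_of_deriv_eq_zero (fun τ => (h1 τ).differentiableAt)
          (fun τ => (h1 τ).deriv) τ 0
        simp only [neg_zero, hTQ0, add_zero] at h2
        linarith
      have hσodd : σQ (-r) = -σQ r := by
        rw [← hmono.injective.eq_iff, hr, hodd, hr]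
      simp only [hQ, zero_add, zero_sub, hσodd, kink_neg, hv0]
      push_cast
      ring
  have hTs : Tendsto (fun τ : ℝ => A ^ 2 - kink A τ ^ 2) atTop (𝓝 0) := by
    convert ((tendsto_kink_atTop hA).pow 2).const_sub (A ^ 2) using 2
    ring
  have hTs' : Tendsto (fun τ : ℝ => A ^ 2 - kink A τ ^ 2) atBot (𝓝 0) := by
    convert ((tendsto_kink_atBot hA).pow 2).const_sub (A ^ 2) using 2
    ring
  have hP := hV.isStarkSolution_parabolicOrbit ha hT
  have hPd := hV.hasDerivAt_parabolicOrbit ha hT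
  obtain ⟨d, hd, hdP⟩ := hV.exists_parabolicOrbit_add ha hV0 hbrake hT
  have hper : Function.Periodic (parabolicOrbit a V σ) (d + d) := fun t => by
    rw [← add_assoc, hdP, hdP, Complex.conj_conj]
  have hP'd : ∀ t, HasDerivAt (deriv (parabolicOrbit a V σ))
      (starkForce (parabolicOrbit a V σ t)) t := fun t => hP.newton t (parabolicOrbit_ne_zero ha t)
  have hP'c : Continuous (deriv (parabolicOrbit a V σ)) :=
    continuous_iff_continuousAt.2 fun t => (hP'd t).continuousAt
  have hP''c : Continuous (deriv (deriv (parabolicOrbit a V σ))) := by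
    rw [funext fun t => (hP'd t).deriv]
    refine continuous_iff_continuousAt.2 fun t => ?_
    exact ContinuousAt.comp (f := parabolicOrbit a V σ) (g := starkForce)
      (IsStarkSolution.contDiffAt_starkForce (parabolicOrbit_ne_zero ha t)).continuousAt
      hP.continuous.continuousAt
  have hPu : UniformContinuous (parabolicOrbit a V σ) :=
    uniformContinuous_of_periodic_deriv (fun t => (hPd t).differentiableAt) hP'c
      hper.deriv_of_real (by positivity)
  have hPu' : UniformContinuous (deriv (parabolicOrbit a V σ)) :=
    uniformContinuous_of_periodic_deriv (fun t => (hP'd t).differentiableAt) hP''c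
      hper.deriv_of_real.deriv_of_real (by positivity)
  have hQT : ∀ τ, Q (TQ τ) = ((kink A τ : ℂ) + v τ * Complex.I) ^ 2 / 2 := fun τ => by
    simp only [hQ, hl]
  have hQT' : ∀ τ, kink A τ ≠ 0 → deriv Q (TQ τ) =
      (((A ^ 2 - kink A τ ^ 2 : ℝ) : ℂ) + v' τ * Complex.I) / ((kink A τ : ℂ) - v τ * Complex.I) := by
    intro τ hτ
    have hne : kink A (σQ (TQ τ)) ^ 2 + v (σQ (TQ τ)) ^ 2 ≠ 0 := by
      rw [hl]; positivity
    have := (hasDerivAt_leviCivita (t := TQ τ) (hu _) (hvd _) hne (hσd _ hne)).deriv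
    rw [hl] at this
    exact this
  have hPT : ∀ τ, parabolicOrbit a V σ (T (τ + s)) = ((A : ℂ) + v τ * Complex.I) ^ 2 / 2 :=
    fun τ => by simp only [parabolicOrbit, hT.left_inv, hv, hAdef]
  have hPT' : ∀ τ, deriv (parabolicOrbit a V σ) (T (τ + s)) =
      (v' τ * Complex.I) / ((A : ℂ) - v τ * Complex.I) := fun τ => by
    rw [(hPd _).deriv, hT.left_inv]
  have hdP' : ∀ t, deriv (parabolicOrbit a V σ) (t + d) =
      conj (deriv (parabolicOrbit a V σ) t) := fun t => by
    rw [← deriv_comp_add_const, funext hdP, deriv_comp_conj]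
  refine ⟨Q, hQsol, fun t => ?_, ?_, ?_, ?_⟩
  · have e : ‖Q t‖ + (Q t).re = kink A (σQ t) ^ 2 := by rw [hQnorm, hQre]; ring
    rw [e, pow_eq_zero_iff two_ne_zero, kink_eq_zero_iff hA, hσ0]
  · rw [hQnorm, (hσ0 0).2 rfl, kink_zero]
    simp [hv]
  · refine isAsymptoticTo_of_tendsto (v := v) (v' := v') (T := fun τ => T (τ + s)) (d := 0)
      (e := T s) hA.ne' hPu hPu' (tendsto_kink_atTop hA) hTs hvle hvle' hQT hQT' ?_ ?_
      (fun _ => rfl) hσtop hr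
    · simpa only [add_zero] using hPT
    · simpa only [add_zero] using hPT'
  -- In the past `u` tends to `-A`, which gives the reflected orbit; the half period `d` undoes the
  -- reflection.
  · refine isAsymptoticTo_of_tendsto (v := v) (v' := v') (T := fun τ => T (τ + s)) (d := d)
      (e := T s) (neg_ne_zero.2 hA.ne') hPu hPu' (tendsto_kink_atBot hA) hTs' hvle hvle' hQT hQT'
      (fun τ => ?_) (fun τ => ?_) (fun _ => rfl) hσbot hr
    · rw [hdP, hPT]
      simp only [map_div₀, map_pow, map_add, map_mul, Complex.conj_ofReal, Complex.conj_I,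
        map_ofNat]
      push_cast
      ring
    · rw [hdP', hPT']
      simp only [map_div₀, map_sub, map_mul, Complex.conj_ofReal, Complex.conj_I]
      push_cast
      rw [← neg_div_neg_eq]
      congr 1 <;> ring

end IsTransverseMotion

/-! ### The main theorem -/

theorem theorem1 (a : ℝ) (ha : 0 < a) (ha1 : a ≤ 1) :
    -- symmetry; bounded iff `b ≤ √(2 / a - 2 a)`
    (∀ b : ℝ, 0 ≤ b → ∀ q : ℝ → ℂ, IsStarkSolutionFrom a b q →
      (∀ t, q (-t) = conj (q t)) ∧
      (Bornology.IsBounded (Set.range q) ↔ b ≤ √(2 / a - 2 * a))) ∧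
    -- `qs` is the solution for `b = √(2 / a - 2 a)`
    ∃ qs : ℝ → ℂ,
      (∀ q : ℝ → ℂ, IsStarkSolutionFrom a (√(2 / a - 2 * a)) q ↔ q = qs) ∧
      -- it is a brake orbit
      IsBrakeOrbit qs ∧
      -- it lies on a parabola, with known energy
      (∀ t, ‖qs t‖ + (qs t).re = 2 * a) ∧
      (∀ t, starkEnergy (qs t) (deriv qs t) = -2 * a) ∧
      -- the moments of zero velocity
      (∀ t, HasDerivAt qs 0 t ↔ ‖qs t‖ = 1) ∧
      -- solutions asymptotic to it in both time directions
      (∃ Q : ℕ → ℝ → ℂ, Function.Injective Q ∧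
        (∀ n, IsStarkSolution (Q n) ∧ (∀ s : ℝ, Q n ≠ fun t => qs (t + s)) ∧
          IsAsymptoticTo (Q n) qs atTop ∧ IsAsymptoticTo (Q n) qs atBot) ∧
        (a < 1 →
          (∀ n t, Q n t ≠ 0) ∧
          ∀ m n, m ≠ n → ∀ s : ℝ,
            (Q m ≠ fun t => Q n (t + s)) ∧ (Q m ≠ fun t => conj (Q n (t + s))))) ∧
      -- uniqueness, up to reflection in the x-axis
      (Bornology.IsBounded (Set.range qs) ∧ AvoidsNegativeAxis qs ∧
        ∀ q : ℝ → ℂ, IsStarkSolution q → q 0 = (a : ℂ) →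
          Bornology.IsBounded (Set.range q) → AvoidsNegativeAxis q →
          q = qs ∨ q = fun t => conj (qs t)) := by
  obtain ⟨V, V', hV, hV0, hbrake, hphase⟩ := exists_transverseMotion ha ha1
  obtain ⟨T, σ, hT⟩ := hV.exists_regularizedTime ha
  set qs := parabolicOrbit a V σ with hqs
  have hfrom : IsStarkSolutionFrom a (√(2 / a - 2 * a)) qs :=
    hV.isStarkSolutionFrom_parabolicOrbit ha hV0 hT
  have hR : 0 ≤ 2 / a - 2 * a := by
    rw [sub_nonneg, le_div_iff₀ ha]
    nlinarith
  have h2a := IsTransverseMotion.sq_sqrt_two_mul ha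
  have hA : 0 < √(2 * a) := Real.sqrt_pos.2 (by positivity)
  have hd := hV.hasDerivAt_parabolicOrbit ha hT
  have hnorm : ∀ t, ‖qs t‖ = (2 * a + V (σ t) ^ 2) / 2 :=
    IsTransverseMotion.norm_parabolicOrbit ha
  have hre : ∀ t, (qs t).re = (2 * a - V (σ t) ^ 2) / 2 := IsTransverseMotion.re_parabolicOrbit ha
  have hpar : ∀ t, ‖qs t‖ + (qs t).re = 2 * a := fun t => by
    rw [hnorm, hre]; ring
  obtain ⟨d, hd0, hdq⟩ : ∃ d, 0 < d ∧ ∀ t, qs (t + d) = conj (qs t) :=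
    hV.exists_parabolicOrbit_add ha hV0 hbrake hT
  have hper : Function.Periodic qs (d + d) := fun t => by
    rw [← add_assoc, hdq, hdq, Complex.conj_conj]
  have hbdd : Bornology.IsBounded (Set.range qs) :=
    hper.isBounded_of_continuous (by positivity) hfrom.1.continuous
  have hden : ∀ t, ((√(2 * a) : ℝ) : ℂ) - V (σ t) * Complex.I ≠ 0 := fun t => by
    refine norm_pos_iff.1 (lt_of_lt_of_le ?_ (abs_le_norm_sub_mul_I _ _))
    exact abs_pos.2 hA.ne'
  have hrest : ∀ t, HasDerivAt qs 0 t ↔ V' (σ t) = 0 := fun t => by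
    refine ⟨fun h => ?_, fun h => (hd t).congr_deriv (by rw [h]; simp)⟩
    have := (hd t).unique h
    rw [div_eq_zero_iff, or_iff_left (hden t)] at this
    simpa using this
  have huniq : ∀ q : ℝ → ℂ, IsStarkSolutionFrom a (√(2 / a - 2 * a)) q → q = qs :=
    fun q hq => hq.eq ha.ne' hfrom
  refine ⟨fun b hb q hq => ⟨hq.neg_eq_conj ha.ne', ?_⟩, qs,
    fun q => ⟨huniq q, fun h => h ▸ hfrom⟩, ⟨hfrom.1, ⟨d + d, by positivity, hper⟩, ?_⟩, hpar,
    fun t => ?_, fun t => ?_, ?_, hbdd, fun t ht => ?_, fun q hq hq0 hqb hav => ?_⟩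
  · rw [Real.le_sqrt hb hR]
    constructor
    · intro h
      by_contra! hlt
      exact hq.not_isBounded ha hlt h
    · intro h
      rcases h.lt_or_eq with h | h
      · exact hq.isBounded ha h
      · rw [huniq q (by rw [← h, Real.sqrt_sq hb]; exact hq)]
        exact hbdd
  · obtain ⟨τ, -, hτ⟩ := hbrake
    exact ⟨T τ, (hrest _).2 (by rw [hT.left_inv, hτ])⟩
  · have h1 : ‖deriv qs t‖ ^ 2 = V' (σ t) ^ 2 / (2 * a + V (σ t) ^ 2) := by
      rw [(hd t).deriv, norm_div, div_pow, norm_mul, Complex.norm_I, mul_one, Complex.norm_real,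
        Real.norm_eq_abs, sq_abs, sq_norm_eq,
        Complex.sub_re, Complex.sub_im, Complex.ofReal_re, Complex.ofReal_im, Complex.re_ofReal_mul,
        Complex.im_ofReal_mul, Complex.I_re, Complex.I_im, mul_zero, mul_one, sub_zero, zero_sub,
        neg_sq, h2a]
    rw [starkEnergy, h1, hnorm, hre, hV.energy]
    have : 0 < 2 * a + V (σ t) ^ 2 := by positivity
    field_simp
    ring
  · have h1 := hV.energy (σ t)
    rw [hrest, hnorm, ← pow_eq_zero_iff (n := 2) two_ne_zero, h1]
    have : 0 < 2 * a + V (σ t) ^ 2 := by positivity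
    constructor
    · intro h
      nlinarith
    · intro h
      rw [div_eq_one_iff_eq two_ne_zero] at h
      rw [h]; norm_num
  -- `r n` is the only time when `Q n` meets the negative axis. For `a < 1` the distances from the
  -- origin at that time separate the orbits.
  · have hkey : ∃ Q : ℕ → ℝ → ℂ, ∃ r : ℕ → ℝ, (∀ n, IsStarkSolution (Q n) ∧
        (∀ t, ‖Q n t‖ + (Q n t).re = 0 ↔ t = r n) ∧
        IsAsymptoticTo (Q n) qs atTop ∧ IsAsymptoticTo (Q n) qs atBot) ∧
        Function.Injective Q ∧ (a < 1 → (∀ n, r n = 0) ∧ (∀ n, Q n 0 ≠ 0) ∧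
          ∀ m n, m ≠ n → ‖Q m 0‖ ≠ ‖Q n 0‖) := by
      rcases ha1.lt_or_eq with h1 | rfl
      · obtain ⟨s, hs, hs'⟩ := hphase h1
        choose Q hQ using fun n =>
          hV.exists_homoclinic ha hV0 hbrake hT (s n) (Or.inl (hs n))
        have hdist : ∀ m n, m ≠ n → ‖Q m 0‖ ≠ ‖Q n 0‖ := fun m n hmn h => by
          rw [(hQ m).2.2.1, (hQ n).2.2.1] at h
          exact hs' m n hmn (by linarith)
        refine ⟨Q, fun _ => 0, fun n => ⟨(hQ n).1, (hQ n).2.1, (hQ n).2.2.2⟩, fun m n h => ?_,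
          fun _ => ⟨fun _ => rfl, fun n h => ?_, hdist⟩⟩
        · by_contra hmn
          exact hdist m n hmn (by rw [h])
        · have := (hQ n).2.2.1
          rw [h, norm_zero] at this
          have := hs n
          have : 0 < V (s n) ^ 2 := by positivity
          linarith
      -- For `a = 1` the transverse phase carries no information, so time translates of one
      -- collision orbit are used; their collision times `-n` distinguish them.
      · obtain ⟨Q, hQ, hQ0, -, hQt, hQb⟩ :=
          hV.exists_homoclinic ha hV0 hbrake hT 0 (Or.inr rfl)
        have hz : ∀ (n : ℕ) t, ‖Q (t + n)‖ + (Q (t + n)).re = 0 ↔ t = -n := fun n t => by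
          rw [hQ0, ← eq_neg_iff_add_eq_zero]
        refine ⟨fun n t => Q (t + n), fun n => -n, fun n => ⟨hQ.comp_add n, hz n,
          hQt.comp_add_atTop n, hQb.comp_add_atBot n⟩, fun m n h => ?_, fun h => absurd h (by simp)⟩
        have h1 := (hz m (-m)).2 rfl
        have h2 := congrFun h (-m : ℝ)
        simp only at h2
        rw [h2, hz n] at h1
        simpa using h1
    obtain ⟨Q, r, hQ, hinj, hlt⟩ := hkey
    refine ⟨Q, hinj, fun n => ⟨(hQ n).1, fun s h => ?_, (hQ n).2.2⟩, fun h1 => ?_⟩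
    -- On every translate of `qs` the coordinate `‖q‖ + x` is `2 a > 0`, whereas on `Q n` it has a
    -- zero.
    · have h1 := ((hQ n).2.1 (r n)).2 rfl
      rw [h, hpar] at h1
      linarith
    · obtain ⟨hr, hne, hdist⟩ := hlt h1
      have hzero : ∀ n t, ‖Q n t‖ + (Q n t).re = 0 ↔ t = 0 := fun n t => by
        rw [(hQ n).2.1, hr]
      refine ⟨fun n t h => ?_, fun m n hmn s => ?_⟩
      · have h2 := (hzero n t).1 (by rw [h]; simp)
        exact hne n (h2 ▸ h)
      -- Norm and real part are invariant under reflection, so one argument excludes both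
      -- coincidences: the crossings at time `0` force `s = 0`, and then the crossing distances
      -- differ.
      · have hshift : ∀ t, ‖Q m t‖ = ‖Q n (t + s)‖ → (Q m t).re = (Q n (t + s)).re → t = 0 →
            False := by
          rintro _ e1 e2 rfl
          have h2 := (hzero m 0).2 rfl
          rw [e1, e2, hzero] at h2
          rw [h2] at e1
          exact hdist m n hmn e1
        constructor <;> intro h <;> refine hshift 0 ?_ ?_ rfl <;> rw [h] <;> simp
  · have h1 := hpar t
    have h2 := sq_norm_eq (qs t)
    rw [ht.1] at h2
    have h3 := norm_nonneg (qs t)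
    have h4 : ‖qs t‖ = -(qs t).re := by
      rw [← sq_eq_sq₀ h3 (by linarith [ht.2]), h2]; ring
    linarith
  · rcases hq.isStarkSolutionFrom_of_avoids ha hq0 hqb hav with h | h
    · exact Or.inl (huniq q h)
    · right
      have h1 := h.comp_conj
      rw [neg_neg] at h1
      funext t
      rw [← huniq _ h1, Complex.conj_conj]
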